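/- \textbf{Theorem (Functional equation).} Let $\mathbb{F}=\mathbb{F}_q\subset\mathbb{E}=\mathbb{F}_{q^2}$ be finite fields, let $\psi$ be a non-trivial additive character of $\mathbb{F}$, and let $\psi_{\mathbb{E}/\mathbb{F}}$ be a non-trivial additive character of $\mathbb{E}$ that is trivial on $\mathbb{F}$. Let $n\ge 1$, let $N_n$ be the group of upper triangular unipotent matrices in $\mathrm{GL}_n$, let $w_n$ be the permutation matrix with ones on the antidiagonal, and let $e_n=(0,\dots,0,1)$. Let $\pi$ be an irreducible cuspidal complex representation of $\mathrm{GL}_n(\mathbb{E})$. Its Whittaker model $\mathcal{W}(\pi,\psi_{\mathbb{E}/\mathbb{F}})$ is the space of functions on $\mathrm{GL}_n(\mathbb{E})$ spanned by $g\mapsto\lambda(\pi(g)v)$ with $v\in V_\pi$ and $\lambda$ a linear functional on $V_\pi$ such that $\lambda(\pi(u)v)=\psi_{\mathbb{E}/\mathbb{F}}(u_{1,2}+\dots+u_{n-1,n})\,\lambda(v)$ for all $u\in N_n(\mathbb{E})$ and $v\in V_\pi$. For $W\in\mathcal{W}(\pi,\psi_{\mathbb{E}/\mathbb{F}})$ and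 $\phi:\mathbb{F}^n\to\mathbb{C}$ put $\check W(g)=W(w_n\,{}^tg^{-1})$, $\mathcal{F}_\psi(\phi)(y)=q^{-n/2}\sum_{x\in\mathbb{F}^n}\phi(x)\psi(x\cdot{}^ty)$, \[ I(W,\phi)=\sum_{g\in N_n(\mathbb{F})\backslash \mathrm{GL}_n(\mathbb{F})}W(g)\,\phi(e_ng),\qquad \check I(W,\phi)=\sum_{g\in N_n(\mathbb{F})\backslash \mathrm{GL}_n(\mathbb{F})}\check W(g)\,\mathcal{F}_\psi(\phi)(e_ng). \] The Asai gamma factor $\gamma(\pi,\mathrm{As},\psi)$ is the complex number, which exists and is unique, such that $\gamma(\pi,\mathrm{As},\psi)\,I(W,\phi)=\check I(W,\phi)$ for all $W\in\mathcal{W}(\pi,\psi_{\mathbb{E}/\mathbb{F}})$ and all $\phi$ with $\phi(0)=0$. For the contragredient $\check\pi$, the factor $\gamma(\check\pi,\mathrm{As},\psi^{-1})$ is defined in the same way with $\psi^{-1}$ and $\psi_{\mathbb{E}/\mathbb{F}}^{-1}$ in place of $\psi$ and $\psi_{\mathbb{E}/\mathbb{F}}$. A Flicker--Rallis vector of $\pi$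 is a non-zero vector of $V_\pi$ fixed by $\mathrm{GL}_n(\mathbb{F})$. \begin{enumerate} \item If $\pi$ does not admit a Flicker--Rallis vector, then \[\gamma(\pi,\mathrm{As},\psi)\,\gamma(\check\pi,\mathrm{As},\psi^{-1})=1\quad\text{and}\quad|\gamma(\pi,\mathrm{As},\psi)|=1.\] \item If $n$ is odd and $\pi$ admits a Flicker--Rallis vector, then \[\gamma(\pi,\mathrm{As},\psi)\,\gamma(\check\pi,\mathrm{As},\psi^{-1})=q^{-n},\qquad \gamma(\pi,\mathrm{As},\psi)=-q^{-n/2},\] and in particular $|\gamma(\pi,\mathrm{As},\psi)|=q^{-n/2}$. \end{enumerate} -/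

import Mathlib

open scoped Matrix

namespace FiniteAsai

noncomputable section

/-- The unipotent radical `N_n(R)` of the standard Borel subgroup of `GL_n(R)`: upper triangular
matrices with ones on the diagonal. -/
def unipotent (n : ℕ) (R : Type*) [CommRing R] : Subgroup (GL (Fin n) R) where
  carrier := {g | (∀ i j, j < i → g.1 i j = 0) ∧ ∀ i, g.1 i i = 1}
  one_mem' := by
    refine ⟨fun i j h => ?_, fun i => ?_⟩
    · simp [Matrix.one_apply_ne (ne_of_gt h)]
    · simp
  mul_mem' := by
    rintro a b ⟨ha, ha'⟩ ⟨hb, hb'⟩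
    refine ⟨fun i j h => ?_, fun i => ?_⟩
    · rw [Units.val_mul, Matrix.mul_apply]
      refine Finset.sum_eq_zero fun k _ => ?_
      rcases lt_or_ge k i with hk | hk
      · rw [ha i k hk, zero_mul]
      · rw [hb k j (lt_of_lt_of_le h hk), mul_zero]
    · rw [Units.val_mul, Matrix.mul_apply, Finset.sum_eq_single i]
      · rw [ha' i, hb' i, one_mul]
      · intro k _ hk
        rcases lt_or_gt_of_ne hk with hk | hk
        · rw [ha i k hk, zero_mul]
        · rw [hb k i hk, mul_zero]
      · simp
  inv_mem' := by
    rintro a ⟨ha, ha'⟩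
    have hinv : ∀ i j, j < i → (a⁻¹).1 i j = 0 := by
      intro i j h
      have hT : Matrix.BlockTriangular a.1 id := fun i j h => ha i j h
      let _ : Invertible a.1 := Units.invertible a
      have := Matrix.blockTriangular_inv_of_blockTriangular hT
      rw [← Matrix.coe_units_inv] at this
      exact this h
    refine ⟨hinv, fun i => ?_⟩
    have h1 : (a * a⁻¹).1 i i = 1 := by simp
    rw [Units.val_mul, Matrix.mul_apply, Finset.sum_eq_single i] at h1
    · rwa [ha' i, one_mul] at h1
    · intro k _ hk
      rcases lt_or_gt_of_ne hk with hk | hk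
      · rw [ha i k hk, zero_mul]
      · rw [hinv k i hk, mul_zero]
    · simp

/-- The value `ψ(u_{1,2} + ⋯ + u_{n-1,n})`; on `N_n(R)` this is the character attached to the
additive character `ψ`. -/
def superdiagChar {n : ℕ} {R : Type*} [CommRing R] (ψ : AddChar R ℂ) (u : GL (Fin n) R) : ℂ :=
  ψ (∑ i : Fin n, ∑ j : Fin n, if j.val = i.val + 1 then u.1 i j else 0)

/-- The longest Weyl element `w_n`, with ones on the antidiagonal. -/
def weyl (n : ℕ) (R : Type*) [CommRing R] : GL (Fin n) R where
  val := Matrix.of fun i j => if j = Fin.rev i then 1 else 0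
  inv := Matrix.of fun i j => if j = Fin.rev i then 1 else 0
  val_inv := by
    ext i j
    rw [Matrix.mul_apply, Finset.sum_eq_single (Fin.rev i)]
    · simp [Matrix.one_apply, eq_comm]
    · intro k _ hk
      simp [hk]
    · simp
  inv_val := by
    ext i j
    rw [Matrix.mul_apply, Finset.sum_eq_single (Fin.rev i)]
    · simp [Matrix.one_apply, eq_comm]
    · intro k _ hk
      simp [hk]
    · simp

/-- The inverse transpose `ᵗg⁻¹`. -/
def invTranspose {n : ℕ} {R : Type*} [CommRing R] (g : GL (Fin n) R) : GL (Fin n) R where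
  val := (g⁻¹).1ᵀ
  inv := g.1ᵀ
  val_inv := by rw [← Matrix.transpose_mul, ← Units.val_mul]; simp
  inv_val := by rw [← Matrix.transpose_mul, ← Units.val_mul]; simp

/-- The last standard row vector `e_n`. -/
def lastRow (n : ℕ) [NeZero n] (R : Type*) [CommRing R] : Fin n → R :=
  Pi.single ⟨n - 1, Nat.sub_lt (NeZero.pos n) one_pos⟩ 1

section Representation

variable {n : ℕ} {E V : Type*} [Field E] [AddCommGroup V] [Module ℂ V]

/-- Cuspidality: for each standard maximal parabolic subgroup of `GL_n`, of type `(k, n - k)` with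
`0 < k < n`, its unipotent radical has no non-zero fixed vector. (The unipotent radical of any
proper standard parabolic subgroup contains one of these.) -/
def IsCuspidal (π : Representation ℂ (GL (Fin n) E) V) : Prop :=
  ∀ k : ℕ, 0 < k → k < n → ∀ v : V,
    (∀ u : GL (Fin n) E,
      (∀ i j : Fin n, ¬(i.val < k ∧ k ≤ j.val) → u.1 i j = (1 : Matrix (Fin n) (Fin n) E) i j) →
        π u v = v) →
    v = 0

/-- Whittaker functionals: elements of `Hom_{N_n(E)}(π, ψ)`. -/
def IsWhittakerFunctional (π : Representation ℂ (GL (Fin n) E) V) (ψ : AddChar E ℂ)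
    (l : Module.Dual ℂ V) : Prop :=
  ∀ u ∈ unipotent n E, ∀ v : V, l (π u v) = superdiagChar ψ u * l v

/-- The Whittaker model `𝒲(π, ψ)`: the space of functions on `GL_n(E)` spanned by the Whittaker
functions `g ↦ l (π(g) v)`. -/
def whittakerModel (π : Representation ℂ (GL (Fin n) E) V) (ψ : AddChar E ℂ) :
    Submodule ℂ (GL (Fin n) E → ℂ) :=
  Submodule.span ℂ
    {W | ∃ l : Module.Dual ℂ V, IsWhittakerFunctional π ψ l ∧ ∃ v : V, W = fun g => l (π g v)}

/-- `W̌(g) = W(w_n ᵗg⁻¹)`. -/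
def dualWhittaker (W : GL (Fin n) E → ℂ) : GL (Fin n) E → ℂ :=
  fun g => W (weyl n E * invTranspose g)

end Representation

section Flicker

variable {n : ℕ} {F E V : Type*} [Field F] [Field E] [Algebra F E] [AddCommGroup V] [Module ℂ V]

/-- The inclusion `GL_n(F) → GL_n(E)`. -/
def baseGL (n : ℕ) (F E : Type*) [Field F] [Field E] [Algebra F E] :
    GL (Fin n) F →* GL (Fin n) E :=
  Matrix.GeneralLinearGroup.map (algebraMap F E)

/-- `π` admits a Flicker–Rallis vector: a non-zero vector fixed by `GL_n(F)`. -/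
def HasFlickerRallisVector (F : Type*) [Field F] [Algebra F E]
    (π : Representation ℂ (GL (Fin n) E) V) : Prop :=
  ∃ v : V, v ≠ 0 ∧ ∀ g : GL (Fin n) F, π (baseGL n F E g) v = v

/-- The sum `∑_{g ∈ N_n(F) \ GL_n(F)} f(g)` of a left `N_n(F)`-invariant function over the finite
set of cosets `N_n(F) g`, computed with one representative of each coset. -/
def cosetSum (f : GL (Fin n) F → ℂ) : ℂ :=
  ∑ᶠ x : Quotient (QuotientGroup.rightRel (unipotent n F)), f x.out

/-- The Fourier transform `ℱ_ψ(φ)(y) = q^{-n/2} ∑_{x ∈ Fⁿ} φ(x) ψ(x · ᵗy)`. -/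
def fourier [Fintype F] (ψ : AddChar F ℂ) (φ : (Fin n → F) → ℂ) : (Fin n → F) → ℂ :=
  fun y => (((Fintype.card F : ℝ) ^ (-(n : ℝ) / 2) : ℝ) : ℂ) * ∑ x : Fin n → F, φ x * ψ (x ⬝ᵥ y)

/-- The Flicker sum `I(W, φ) = ∑_{g ∈ N_n(F) \ GL_n(F)} W(g) φ(e_n g)`. -/
def flickerSum [NeZero n] (W : GL (Fin n) E → ℂ) (φ : (Fin n → F) → ℂ) : ℂ :=
  cosetSum fun g : GL (Fin n) F => W (baseGL n F E g) * φ (lastRow n F ᵥ* g.1)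

/-- The dual Flicker sum `Ǐ(W, φ) = ∑_{g ∈ N_n(F) \ GL_n(F)} W̌(g) ℱ_ψ(φ)(e_n g)`. -/
def dualFlickerSum [Fintype F] [NeZero n] (ψ : AddChar F ℂ) (W : GL (Fin n) E → ℂ)
    (φ : (Fin n → F) → ℂ) : ℂ :=
  flickerSum (dualWhittaker W) (fourier ψ φ)

/-- `c` is a constant of proportionality between the Flicker sums and the dual Flicker sums:
`c · I(W, φ) = Ǐ(W, φ)` for all `W ∈ 𝒲(π, ψE)` and all `φ` on `Fⁿ` with `φ(0) = 0`. -/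
def IsAsaiGammaFactor [Fintype F] [NeZero n] (π : Representation ℂ (GL (Fin n) E) V)
    (ψ : AddChar F ℂ) (ψE : AddChar E ℂ) (c : ℂ) : Prop :=
  ∀ W ∈ whittakerModel π ψE, ∀ φ : (Fin n → F) → ℂ, φ 0 = 0 →
    c * flickerSum W φ = dualFlickerSum ψ W φ

/-- The Asai gamma factor `γ(π, As, ψ)`: the constant of proportionality (with an arbitrary value
should there be none). -/
def asaiGamma [Fintype F] [NeZero n] (π : Representation ℂ (GL (Fin n) E) V)
    (ψ : AddChar F ℂ) (ψE : AddChar E ℂ) : ℂ :=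
  Classical.epsilon (IsAsaiGammaFactor π ψ ψE)

end Flicker

end

end FiniteAsai

/-!
The representation `π` is analysed through its Bessel function `J(g) = l(π(g) v)`, where `l` is a
Whittaker functional and `v` a Whittaker vector with `l(v) = 1`.

*Existence and uniqueness of `l` and `v`.* Fourier analysis on one column after the other shows that
every non-zero subspace of a cuspidal representation that is stable under the mirabolic subgroup
contains a Whittaker vector (`exists_whittakerVector`). Uniqueness is Gelfand's trick: by the Bruhat
decomposition, a function on `GL_n(E)` that transforms by `ψ` under `N_n(E)` on both sides is
invariant under `g ↦ w_n ᵗg w_n` (`IsBiequivariant.apply_antiTranspose`), so the compressions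
`e π(g) e` to the Whittaker vectors commute (`mem_span_of_mem_whittakerVectors`). Together these
give that `v` generates `π` under the mirabolic subgroup (`span_mirabolic_orbit`).

*Existence and uniqueness of the gamma factor.* Both `I` and `Ǐ` are `GL_n(F)`-invariant forms in
`(W, φ)`. As `GL_n(F)` is transitive on the non-zero vectors of `Fⁿ`, such a form is determined on
the functions `φ` with `φ(0) = 0` by the functional obtained for `φ = δ_{e_n}`, which is invariant
under the mirabolic subgroup of `GL_n(F)`. An invariant functional of this kind is determined by its
value at `v` (`functional_eq_zero_of_invariant`): its matrix coefficient with `v` on the mirabolic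
subgroup is supported on one double coset, because the annihilator of `F` under `ψ_{E/F}` is `F`.
Since `I(J, δ_{e_n}) = 1`, the gamma factor is `Ǐ(J, δ_{e_n})`
(`IsWhittakerPair.isAsaiGammaFactor_iff`).

*The contragredient.* The invariance of `J` under `g ↦ w_n ᵗg w_n` also shows that `W ↦ W̌` carries
the Whittaker model of `π` to that of its contragredient, and `J` to the translate by `w_n` of the
Bessel function `g ↦ J(g⁻¹)` of the contragredient (`IsWhittakerPair.dualWhittaker_rep`). Since
`J(g⁻¹)` is the complex conjugate of `J(g)`, the gamma factor of the contragredient is the complex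
conjugate of that of `π` (`IsWhittakerPair.asaiGamma_dual`).

*The two cases.* The functional `W ↦ I(W, 1)` is `GL_n(F)`-invariant. If there is no Flicker–Rallis
vector, it vanishes, the functional equation holds for all `φ`, and applying it twice gives
`γ γ̌ = 1` by Fourier inversion (`IsWhittakerPair.asaiGamma_mul_dual`). If there is one, then
`W ↦ I(W, δ_{e_n})` is itself `GL_n(F)`-invariant, hence `I(W, φ) = I(W, δ_{e_n}) ∑_{x ≠ 0} φ(x)`.
Applied to `J̌`, which is a `GL_n(F)`-translate of the Bessel function of the contragredient, this
gives `γ = ∑_{y ≠ 0} ℱ_ψ(δ_{e_n})(y) = -q^{-n/2}`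
(`IsWhittakerPair.asaiGamma_of_hasFlickerRallisVector`).
-/

open scoped Matrix

namespace FiniteAsai

noncomputable section

/-! ### Unipotent subgroups -/

section Unipotent

variable {n : ℕ} {K : Type*} [Field K]

/-- The subgroup of `GL_n(K)` of the matrices whose rows of index `≥ k` are those of an upper
triangular unipotent matrix: block matrices with an arbitrary invertible upper left block of size
`k`, zero lower left block, and unipotent lower right block. It is `N_n(K)` for `k = 0` and the
mirabolic subgroup (last row `e_n`) for `k = n - 1`. -/
def tailUnipotent (n k : ℕ) (K : Type*) [Field K] : Subgroup (GL (Fin n) K) where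
  carrier := {g | ∀ i : Fin n, k ≤ i.val → (∀ j, j < i → g.1 i j = 0) ∧ g.1 i i = 1}
  one_mem' := by
    refine fun i _ => ⟨fun j h => ?_, ?_⟩
    · simp [Matrix.one_apply_ne (ne_of_gt h)]
    · simp
  mul_mem' := by
    rintro a b ha hb i hi
    refine ⟨fun j h => ?_, ?_⟩
    · rw [Units.val_mul, Matrix.mul_apply]
      refine Finset.sum_eq_zero fun l _ => ?_
      rcases lt_or_ge l i with hl | hl
      · rw [(ha i hi).1 l hl, zero_mul]
      · rw [(hb l (hi.trans hl)).1 j (lt_of_lt_of_le h hl), mul_zero]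
    · rw [Units.val_mul, Matrix.mul_apply, Finset.sum_eq_single i]
      · rw [(ha i hi).2, (hb i hi).2, one_mul]
      · intro l _ hl
        rcases lt_or_gt_of_ne hl with hl | hl
        · rw [(ha i hi).1 l hl, zero_mul]
        · rw [(hb l (hi.trans hl.le)).1 i hl, mul_zero]
      · simp
  inv_mem' := by
    rintro a ha
    have hinv : ∀ i j : Fin n, k ≤ i.val → j < i → (a⁻¹).1 i j = 0 := by
      intro i j hi h
      -- the rows below `k` form a single block
      have hT : Matrix.BlockTriangular a.1 (fun i : Fin n => i.val + 1 - k) := by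
        intro i j h
        simp only at h
        exact (ha i (by omega)).1 j (by rw [Fin.lt_def]; omega)
      let _ : Invertible a.1 := Units.invertible a
      have := Matrix.blockTriangular_inv_of_blockTriangular hT
      rw [← Matrix.coe_units_inv] at this
      exact this (by simp only; rw [Fin.lt_def] at h; omega)
    refine fun i hi => ⟨fun j => hinv i j hi, ?_⟩
    have h1 : (a * a⁻¹).1 i i = 1 := by simp
    rw [Units.val_mul, Matrix.mul_apply, Finset.sum_eq_single i] at h1
    · rwa [(ha i hi).2, one_mul] at h1
    · intro l _ hl
      rcases lt_or_gt_of_ne hl with hl | hl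
      · rw [(ha i hi).1 l hl, zero_mul]
      · rw [hinv l i (hi.trans hl.le) hl, mul_zero]
    · simp

theorem mem_tailUnipotent {k : ℕ} {g : GL (Fin n) K} :
    g ∈ tailUnipotent n k K ↔
      ∀ i : Fin n, k ≤ i.val → (∀ j, j < i → g.1 i j = 0) ∧ g.1 i i = 1 := Iff.rfl

theorem mem_unipotent {R : Type*} [CommRing R] {g : GL (Fin n) R} :
    g ∈ unipotent n R ↔ (∀ i j, j < i → g.1 i j = 0) ∧ ∀ i, g.1 i i = 1 := Iff.rfl

theorem tailUnipotent_zero : tailUnipotent n 0 K = unipotent n K := by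
  ext g
  simp only [mem_tailUnipotent, mem_unipotent, Nat.zero_le, forall_const]
  exact ⟨fun h => ⟨fun i => (h i).1, fun i => (h i).2⟩, fun h i => ⟨h.1 i, h.2 i⟩⟩

theorem tailUnipotent_mono {k l : ℕ} (h : k ≤ l) : tailUnipotent n k K ≤ tailUnipotent n l K :=
  fun _ hg i hi => hg i (h.trans hi)

theorem unipotent_le_tailUnipotent (k : ℕ) : unipotent n K ≤ tailUnipotent n k K :=
  tailUnipotent_zero (n := n) (K := K) ▸ tailUnipotent_mono (Nat.zero_le k)

/-- Superdiagonal entries in the unipotent rows add up under multiplication. -/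
theorem superdiag_mul {k : ℕ} {a b : GL (Fin n) K} (ha : a ∈ tailUnipotent n k K)
    (hb : b ∈ tailUnipotent n k K) {i j : Fin n} (hi : k ≤ i.val) (hj : j.val = i.val + 1) :
    (a * b).1 i j = a.1 i j + b.1 i j := by
  have hij : i ≠ j := fun h => by rw [h] at hj; omega
  rw [Units.val_mul, Matrix.mul_apply, Finset.sum_eq_add i j hij, (ha i hi).2,
    (hb j (by omega)).2, one_mul, mul_one, add_comm]
  · rintro l _ ⟨h1, h2⟩
    rcases lt_or_gt_of_ne h1 with h | h
    · rw [(ha i hi).1 l h, zero_mul]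
    · have : j < l := by
        rw [Fin.lt_def] at h ⊢
        have := Fin.val_ne_of_ne h2
        omega
      rw [(hb l (by omega)).1 j this, mul_zero]
  · simp
  · simp

theorem superdiagChar_mul (ψ : AddChar K ℂ) {a b : GL (Fin n) K} (ha : a ∈ unipotent n K)
    (hb : b ∈ unipotent n K) :
    superdiagChar ψ (a * b) = superdiagChar ψ a * superdiagChar ψ b := by
  rw [← tailUnipotent_zero] at ha hb
  simp only [superdiagChar]
  rw [← AddChar.map_add_eq_mul, ← Finset.sum_add_distrib]
  congr 1
  refine Finset.sum_congr rfl fun i _ => ?_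
  rw [← Finset.sum_add_distrib]
  refine Finset.sum_congr rfl fun j _ => ?_
  split_ifs with h
  · exact superdiag_mul ha hb (Nat.zero_le _) h
  · simp

@[simp]
theorem superdiagChar_one (ψ : AddChar K ℂ) : superdiagChar ψ (1 : GL (Fin n) K) = 1 := by
  rw [superdiagChar, Finset.sum_eq_zero, AddChar.map_zero_eq_one]
  refine fun i _ => Finset.sum_eq_zero fun j _ => ?_
  split_ifs with h
  · exact Matrix.one_apply_ne fun e => by rw [e] at h; omega
  · rfl

theorem superdiagChar_ne_zero (ψ : AddChar K ℂ) (u : GL (Fin n) K) : superdiagChar ψ u ≠ 0 :=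
  (AddChar.val_isUnit ψ _).ne_zero

theorem superdiagChar_inv (ψ : AddChar K ℂ) {u : GL (Fin n) K} (hu : u ∈ unipotent n K) :
    superdiagChar ψ u⁻¹ = (superdiagChar ψ u)⁻¹ := by
  refine eq_inv_of_mul_eq_one_left ?_
  rw [← superdiagChar_mul ψ (inv_mem hu) hu, inv_mul_cancel, superdiagChar_one]

theorem superdiagChar_inv_char (ψ : AddChar K ℂ) (u : GL (Fin n) K) :
    superdiagChar ψ⁻¹ u = (superdiagChar ψ u)⁻¹ := by
  rw [superdiagChar, superdiagChar, AddChar.inv_apply, AddChar.map_neg_eq_inv]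

/-- The elements of `N_n(K)` whose columns of index `< k` are standard basis vectors. -/
def IsColTail (k : ℕ) (u : GL (Fin n) K) : Prop :=
  u ∈ unipotent n K ∧ ∀ i j : Fin n, j.val < k → u.1 i j = (1 : Matrix (Fin n) (Fin n) K) i j

/-- `tailUnipotent n c K` normalizes the group of `IsColTail (c + 1)` elements. -/
theorem IsColTail.conj {c : ℕ} {z h : GL (Fin n) K} (hh : IsColTail (c + 1) h)
    (hz : z ∈ tailUnipotent n c K) : IsColTail (c + 1) (z⁻¹ * h * z) := by
  have hcol : ∀ i j : Fin n, j.val < c + 1 →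
      (z⁻¹ * h * z).1 i j = (1 : Matrix (Fin n) (Fin n) K) i j := by
    intro i j hj
    have hhz : ∀ l : Fin n, (h * z).1 l j = z.1 l j := by
      intro l
      have : z.1 l j = ((1 : Matrix (Fin n) (Fin n) K) * z.1) l j := by rw [one_mul]
      rw [this, Units.val_mul, Matrix.mul_apply, Matrix.mul_apply]
      refine Finset.sum_congr rfl fun m _ => ?_
      rcases lt_or_ge m.val (c + 1) with hm | hm
      · rw [hh.2 l m hm]
      · rw [(hz m (by omega)).1 j (by rw [Fin.lt_def]; omega), mul_zero, mul_zero]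
    rw [mul_assoc, Units.val_mul, Matrix.mul_apply]
    simp only [hhz]
    rw [← Matrix.mul_apply, ← Units.val_mul]
    simp
  have hT : z⁻¹ * h * z ∈ tailUnipotent n c K :=
    mul_mem (mul_mem (inv_mem hz) (unipotent_le_tailUnipotent c hh.1)) hz
  refine ⟨⟨fun i j hij => ?_, fun i => ?_⟩, hcol⟩
  · rcases lt_or_ge i.val c with hi | hi
    · rw [hcol i j (by rw [Fin.lt_def] at hij; omega), Matrix.one_apply_ne (ne_of_gt hij)]
    · exact (hT i hi).1 j hij
  · rcases lt_or_ge i.val c with hi | hi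
    · rw [hcol i i (by omega), Matrix.one_apply_eq]
    · exact (hT i hi).2

theorem superdiagChar_conj (ψ : AddChar K ℂ) {c : ℕ} {z h : GL (Fin n) K}
    (hh : IsColTail (c + 1) h) (hz : z ∈ tailUnipotent n c K) :
    superdiagChar ψ (z⁻¹ * h * z) = superdiagChar ψ h := by
  have hh' := hh.conj hz
  simp only [superdiagChar]
  congr 1
  refine Finset.sum_congr rfl fun i _ => Finset.sum_congr rfl fun j _ => ?_
  split_ifs with hj
  · rcases lt_or_ge i.val c with hi | hi
    · rw [hh'.2 i j (by omega), hh.2 i j (by omega)]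
    · have e : z * (z⁻¹ * h * z) = h * z := by group
      have h1 := superdiag_mul hz (unipotent_le_tailUnipotent c hh'.1) hi hj
      have h2 := superdiag_mul (unipotent_le_tailUnipotent c hh.1) hz hi hj
      rw [e, h2, add_comm] at h1
      exact (add_left_cancel h1).symm
  · rfl

/-- The unipotent matrix whose only non-trivial column is that of index `c`, with the entries `x i`
above the diagonal. The entries `x i` with `c ≤ i` are ignored. -/
def colUnipotent (c : Fin n) (x : Fin n → K) : GL (Fin n) K where
  val := 1 + Matrix.of fun i j => if j = c ∧ i < c then x i else 0
  inv := 1 + Matrix.of fun i j => if j = c ∧ i < c then -x i else 0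
  val_inv := by
    rw [add_mul, one_mul, mul_add, mul_one]
    have : (Matrix.of fun i j => if j = c ∧ i < c then x i else 0) *
        (Matrix.of fun i j => if j = c ∧ i < c then -x i else 0) = 0 := by
      ext i j
      rw [Matrix.mul_apply]
      refine Finset.sum_eq_zero fun l _ => ?_
      by_cases h : l = c <;> simp [h]
    rw [this]
    ext i j
    simp only [Matrix.add_apply, Matrix.of_apply, Matrix.zero_apply]
    split_ifs <;> ring
  inv_val := by
    rw [add_mul, one_mul, mul_add, mul_one]
    have : (Matrix.of fun i j => if j = c ∧ i < c then -x i else 0) *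
        (Matrix.of fun i j => if j = c ∧ i < c then x i else 0) = 0 := by
      ext i j
      rw [Matrix.mul_apply]
      refine Finset.sum_eq_zero fun l _ => ?_
      by_cases h : l = c <;> simp [h]
    rw [this]
    ext i j
    simp only [Matrix.add_apply, Matrix.of_apply, Matrix.zero_apply]
    split_ifs <;> ring

theorem colUnipotent_apply (c : Fin n) (x : Fin n → K) (i j : Fin n) :
    (colUnipotent c x).1 i j =
      (1 : Matrix (Fin n) (Fin n) K) i j + if j = c ∧ i < c then x i else 0 := rfl

theorem mul_colUnipotent_apply (g : GL (Fin n) K) (c : Fin n) (x : Fin n → K) (i j : Fin n) :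
    (g * colUnipotent c x).1 i j =
      g.1 i j + if j = c then ∑ l, g.1 i l * (if l < c then x l else 0) else 0 := by
  rw [Units.val_mul, Matrix.mul_apply]
  simp only [colUnipotent_apply, mul_add, Finset.sum_add_distrib]
  rw [← Matrix.mul_apply, mul_one]
  split_ifs with h <;> simp [h]

theorem colUnipotent_mul_apply (g : GL (Fin n) K) (c : Fin n) (x : Fin n → K) (i j : Fin n) :
    (colUnipotent c x * g).1 i j = g.1 i j + if i < c then x i * g.1 c j else 0 := by
  rw [Units.val_mul, Matrix.mul_apply]
  simp only [colUnipotent_apply, add_mul, Finset.sum_add_distrib]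
  rw [← Matrix.mul_apply, one_mul]
  congr 1
  rw [Finset.sum_eq_single c]
  · simp
  · intro l _ hl
    simp [hl]
  · simp

theorem colUnipotent_add (c : Fin n) (x y : Fin n → K) :
    colUnipotent c (x + y) = colUnipotent c x * colUnipotent c y := by
  apply Units.ext
  ext i j
  rw [colUnipotent_mul_apply, colUnipotent_apply, colUnipotent_apply, colUnipotent_apply]
  by_cases h1 : i < c <;> by_cases h2 : j = c
  · subst h2; simp [h1]; ring
  · simp [h1, h2, Matrix.one_apply_ne (Ne.symm h2)]
  · simp [h1, h2]
  · simp [h1, h2]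

@[simp]
theorem colUnipotent_zero (c : Fin n) : colUnipotent c (0 : Fin n → K) = 1 := by
  apply Units.ext
  ext i j
  simp [colUnipotent_apply]

theorem colUnipotent_neg (c : Fin n) (x : Fin n → K) :
    colUnipotent c (-x) = (colUnipotent c x)⁻¹ := by
  refine eq_inv_of_mul_eq_one_left ?_
  rw [← colUnipotent_add, neg_add_cancel, colUnipotent_zero]

theorem conj_colUnipotent_apply {c : Fin n} {p : GL (Fin n) K} (x : Fin n → K) (i j : Fin n) :
    (p * colUnipotent c x * p⁻¹).1 i j = (1 : Matrix (Fin n) (Fin n) K) i j +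
      (∑ l, p.1 i l * (if l < c then x l else 0)) * (p⁻¹).1 c j := by
  rw [Units.val_mul, Matrix.mul_apply]
  simp only [mul_colUnipotent_apply, add_mul, Finset.sum_add_distrib, ite_mul, zero_mul]
  rw [← Matrix.mul_apply, ← Units.val_mul, mul_inv_cancel, Units.val_one]
  congr 1
  simp

theorem conj_colUnipotent_mem {c : Fin n} {p : GL (Fin n) K} (hp : p ∈ tailUnipotent n c.val K)
    (x : Fin n → K) : p * colUnipotent c x * p⁻¹ ∈ unipotent n K := by
  have hp' := inv_mem hp
  have h0 : ∀ i, c ≤ i → ∑ l, p.1 i l * (if l < c then x l else 0) = 0 := by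
    refine fun i hi => Finset.sum_eq_zero fun l _ => ?_
    split_ifs with hl
    · rw [(hp i hi).1 l (lt_of_lt_of_le hl hi), zero_mul]
    · rw [mul_zero]
  refine ⟨fun i j hij => ?_, fun i => ?_⟩
  · rw [conj_colUnipotent_apply, Matrix.one_apply_ne (ne_of_gt hij), zero_add]
    rcases lt_or_ge i c with hi | hi
    · rw [(hp' c le_rfl).1 j (hij.trans hi), mul_zero]
    · rw [h0 i hi, zero_mul]
  · rw [conj_colUnipotent_apply, Matrix.one_apply_eq]
    rcases lt_or_ge i c with hi | hi
    · rw [(hp' c le_rfl).1 i hi, mul_zero, add_zero]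
    · rw [h0 i hi, zero_mul, add_zero]

theorem superdiagChar_conj_colUnipotent (ψ : AddChar K ℂ) {r c : Fin n} (hrc : c.val = r.val + 1)
    {p : GL (Fin n) K} (hp : p ∈ tailUnipotent n c.val K) (x : Fin n → K) :
    superdiagChar ψ (p * colUnipotent c x * p⁻¹) =
      ψ (∑ l, p.1 r l * (if l < c then x l else 0)) := by
  have hp' := inv_mem hp
  rw [superdiagChar, Finset.sum_eq_single r, Finset.sum_eq_single c, if_pos hrc,
    conj_colUnipotent_apply, (hp' c le_rfl).2, mul_one,
    Matrix.one_apply_ne (fun h => by rw [h] at hrc; omega), zero_add]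
  · intro j _ hj
    rw [if_neg]
    intro h
    exact hj (Fin.ext (h.trans hrc.symm))
  · simp
  · intro i _ hi
    refine Finset.sum_eq_zero fun j _ => ?_
    split_ifs with h
    · rw [conj_colUnipotent_apply, Matrix.one_apply_ne (fun e => by rw [e] at h; omega), zero_add]
      have hi' := Fin.val_ne_of_ne hi
      rcases lt_or_ge i c with hic | hic
      · rw [(hp' c le_rfl).1 j (by rw [Fin.lt_def] at *; omega), mul_zero]
      · rw [Finset.sum_eq_zero, zero_mul]
        intro l _
        split_ifs with hl
        · rw [(hp i hic).1 l (lt_of_lt_of_le hl hic), zero_mul]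
        · rw [mul_zero]
    · rfl
  · simp

theorem colUnipotent_mem (c : Fin n) (x : Fin n → K) : colUnipotent c x ∈ unipotent n K := by
  simpa using conj_colUnipotent_mem (one_mem (tailUnipotent n c.val K)) x

theorem superdiagChar_colUnipotent (ψ : AddChar K ℂ) {r c : Fin n} (hrc : c.val = r.val + 1)
    (x : Fin n → K) : superdiagChar ψ (colUnipotent c x) = ψ (x r) := by
  have := superdiagChar_conj_colUnipotent ψ hrc (one_mem (tailUnipotent n c.val K)) x
  rw [one_mul, inv_one, mul_one] at this
  rw [this, Finset.sum_eq_single r]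
  · rw [if_pos (by rw [Fin.lt_def]; omega)]; simp
  · intro l _ hl
    simp [Matrix.one_apply_ne (Ne.symm hl)]
  · simp

/-- A non-zero row vector supported on the coordinates `≤ r` is the row of index `r` of an
invertible matrix that is non-trivial only in the block of the indices `≤ r`. -/
theorem exists_row_eq (r : Fin n) (y : Fin n → K) (hy : ∀ i, r < i → y i = 0) (hy0 : y ≠ 0) :
    ∃ g : GL (Fin n) K, (∀ i j, r < i ∨ r < j → g.1 i j = (1 : Matrix (Fin n) (Fin n) K) i j) ∧
      ∀ j, g.1 r j = y j := by
  obtain ⟨i₀, hi₀⟩ := Function.ne_iff.mp hy0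
  have hi₀r : i₀ ≤ r := not_lt.mp fun h => hi₀ (hy i₀ h)
  let s : Equiv.Perm (Fin n) := Equiv.swap r i₀
  have hs : ∀ j, r < j → s j = j := fun j hj =>
    Equiv.swap_apply_of_ne_of_ne (ne_of_gt hj) (ne_of_gt (lt_of_le_of_lt hi₀r hj))
  let M : Matrix (Fin n) (Fin n) K :=
    ((1 : Matrix (Fin n) (Fin n) K).updateRow r (y ∘ s)).submatrix id s
  have hM : ∀ i j, M i j = if i = r then y j else if i = s j then 1 else 0 := by
    intro i j
    by_cases h : i = r
    · subst h
      simp only [M, Matrix.submatrix_apply, id, Matrix.updateRow_self, Function.comp, if_true]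
      rw [Equiv.swap_apply_self]
    · simp [M, h, Matrix.updateRow_ne, Matrix.one_apply]
  have hdet : IsUnit M.det := by
    have h1 : ((1 : Matrix (Fin n) (Fin n) K).updateRow r (y ∘ s)).det = y i₀ := by
      rw [← Matrix.det_transpose, ← Matrix.updateCol_transpose, Matrix.transpose_one,
        ← Matrix.cramer_apply, Matrix.cramer_one]
      simp [s]
    have h2 : M.det = Equiv.Perm.sign s * y i₀ := by
      rw [← h1, ← Matrix.det_permute']
    rw [h2, isUnit_iff_ne_zero]
    refine mul_ne_zero ?_ hi₀
    rcases Int.units_eq_one_or (Equiv.Perm.sign s) with h | h <;> simp [h]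
  refine ⟨Matrix.GeneralLinearGroup.mk'' M hdet, fun i j hij => ?_, fun j => ?_⟩
  · change M i j = _
    rw [hM, Matrix.one_apply]
    by_cases hir : i = r
    · have hj : r < j := hij.resolve_left (by rw [hir]; exact lt_irrefl _)
      rw [if_pos hir, hy j hj, if_neg (fun h => by rw [← h, hir] at hj; exact lt_irrefl _ hj)]
    · rw [if_neg hir]
      congr 1
      rcases hij with hi | hj
      · rw [← Equiv.symm_apply_eq, Equiv.symm_swap, hs i hi]
      · rw [hs j hj]
  · change M r j = _
    rw [hM, if_pos rfl]

end Unipotent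

/-! ### Bruhat decomposition and bi-equivariant functions -/

section Bruhat

variable {n : ℕ} {K : Type*} [Field K]

/-- The unipotent matrix whose only non-trivial row is that of index `r`, with the entries `y j`
to the right of the diagonal. -/
def rowUnipotent (r : Fin n) (y : Fin n → K) : GL (Fin n) K where
  val := 1 + Matrix.of fun i j => if i = r ∧ r < j then y j else 0
  inv := 1 + Matrix.of fun i j => if i = r ∧ r < j then -y j else 0
  val_inv := by
    rw [add_mul, one_mul, mul_add, mul_one]
    have : (Matrix.of fun i j => if i = r ∧ r < j then y j else 0) *
        (Matrix.of fun i j => if i = r ∧ r < j then -y j else 0) = 0 := by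
      ext i j
      rw [Matrix.mul_apply]
      refine Finset.sum_eq_zero fun l _ => ?_
      by_cases h : l = r <;> simp [h]
    rw [this]
    ext i j
    simp only [Matrix.add_apply, Matrix.of_apply, Matrix.zero_apply]
    split_ifs <;> ring
  inv_val := by
    rw [add_mul, one_mul, mul_add, mul_one]
    have : (Matrix.of fun i j => if i = r ∧ r < j then -y j else 0) *
        (Matrix.of fun i j => if i = r ∧ r < j then y j else 0) = 0 := by
      ext i j
      rw [Matrix.mul_apply]
      refine Finset.sum_eq_zero fun l _ => ?_
      by_cases h : l = r <;> simp [h]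
    rw [this]
    ext i j
    simp only [Matrix.add_apply, Matrix.of_apply, Matrix.zero_apply]
    split_ifs <;> ring

theorem rowUnipotent_apply (r : Fin n) (y : Fin n → K) (i j : Fin n) :
    (rowUnipotent r y).1 i j =
      (1 : Matrix (Fin n) (Fin n) K) i j + if i = r ∧ r < j then y j else 0 := rfl

theorem mul_rowUnipotent_apply (g : GL (Fin n) K) (r : Fin n) (y : Fin n → K) (i j : Fin n) :
    (g * rowUnipotent r y).1 i j = g.1 i j + if r < j then g.1 i r * y j else 0 := by
  rw [Units.val_mul, Matrix.mul_apply]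
  simp only [rowUnipotent_apply, mul_add, Finset.sum_add_distrib]
  rw [← Matrix.mul_apply, mul_one]
  congr 1
  rw [Finset.sum_eq_single r]
  · simp
  · intro l _ hl
    simp [hl]
  · simp

theorem rowUnipotent_mem (r : Fin n) (y : Fin n → K) : rowUnipotent r y ∈ unipotent n K := by
  refine ⟨fun i j hij => ?_, fun i => ?_⟩
  · rw [rowUnipotent_apply, Matrix.one_apply_ne (ne_of_gt hij), if_neg, add_zero]
    rintro ⟨rfl, h⟩
    exact lt_asymm hij h
  · rw [rowUnipotent_apply, Matrix.one_apply_eq, if_neg, add_zero]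
    rintro ⟨rfl, h⟩
    exact lt_irrefl _ h

/-- The entry at `(i, j)` is non-zero and is the only non-zero one in its row and in its column. -/
def IsPivot (A : GL (Fin n) K) (i j : Fin n) : Prop :=
  A.1 i j ≠ 0 ∧ (∀ i', i' ≠ i → A.1 i' j = 0) ∧ ∀ j', j' ≠ j → A.1 i j' = 0

theorem exists_apply_ne_zero (A : GL (Fin n) K) (j : Fin n) : ∃ i, A.1 i j ≠ 0 := by
  by_contra! h
  have h1 : ((A⁻¹).1 * A.1) j j = 1 := by rw [← Units.val_mul]; simp
  rw [Matrix.mul_apply, Finset.sum_eq_zero] at h1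
  · exact zero_ne_one h1
  · intro l _
    rw [h, mul_zero]

/-- Elimination in one column: when the columns to the left of column `k` are already cleared, the
lowest non-zero entry of column `k` serves as pivot, and clearing its column upwards and its row to
the right does not disturb the earlier pivots. -/
theorem exists_pivot_step (A : GL (Fin n) K) (k : Fin n)
    (hA : ∀ j, j < k → ∃ i, IsPivot A i j) :
    ∃ u ∈ unipotent n K, ∃ u' ∈ unipotent n K, ∀ j, j ≤ k → ∃ i, IsPivot (u * A * u') i j := by
  classical
  obtain ⟨i₁, hi₁⟩ := exists_apply_ne_zero A k
  obtain ⟨i₀, hi₀, hmax⟩ := Finset.exists_max_image (Finset.univ.filter fun i => A.1 i k ≠ 0) id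
    ⟨i₁, by simpa using hi₁⟩
  have hp : A.1 i₀ k ≠ 0 := by simpa using hi₀
  have hbelow : ∀ i, i₀ < i → A.1 i k = 0 := by
    intro i hi
    by_contra h
    exact not_lt.mpr (hmax i (by simpa using h)) hi
  have hrow : ∀ j, j < k → A.1 i₀ j = 0 := by
    intro j hj
    obtain ⟨i, h1, h2, h3⟩ := hA j hj
    refine h2 i₀ ?_
    rintro rfl
    exact hp (h3 k (ne_of_gt hj))
  let x : Fin n → K := fun i => -(A.1 i k / A.1 i₀ k)
  let y : Fin n → K := fun j => -(A.1 i₀ j / A.1 i₀ k)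
  let B := colUnipotent i₀ x * A
  have hB : ∀ i j, B.1 i j = A.1 i j + if i < i₀ then x i * A.1 i₀ j else 0 :=
    colUnipotent_mul_apply A i₀ x
  have hBk : ∀ i, i ≠ i₀ → B.1 i k = 0 := by
    intro i hi
    rw [hB]
    split_ifs with h
    · simp only [x]; field_simp; ring
    · rw [hbelow i (lt_of_le_of_ne (not_lt.mp h) (Ne.symm hi)), add_zero]
  have hBi₀ : ∀ j, B.1 i₀ j = A.1 i₀ j := by
    intro j
    rw [hB, if_neg (lt_irrefl _), add_zero]
  have hBlt : ∀ i j, j < k → B.1 i j = A.1 i j := by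
    intro i j hj
    rw [hB, hrow j hj, mul_zero, ite_self, add_zero]
  have hBrow : ∀ i, A.1 i k = 0 → ∀ j, B.1 i j = A.1 i j := by
    intro i hi j
    rw [hB]
    simp [x, hi]
  let C := B * rowUnipotent k y
  have hC : ∀ i j, C.1 i j = B.1 i j + if k < j then B.1 i k * y j else 0 :=
    mul_rowUnipotent_apply B k y
  refine ⟨_, colUnipotent_mem i₀ x, _, rowUnipotent_mem k y, fun j hj => ?_⟩
  change ∃ i, IsPivot C i j
  have hCle : ∀ i j, j ≤ k → C.1 i j = B.1 i j := by
    intro i j hj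
    rw [hC, if_neg (not_lt.mpr hj), add_zero]
  rcases lt_or_eq_of_le hj with hj | rfl
  · obtain ⟨i, h1, h2, h3⟩ := hA j hj
    have hik : A.1 i k = 0 := h3 k (ne_of_gt hj)
    have hii₀ : i ≠ i₀ := fun h => hp (h ▸ hik)
    refine ⟨i, ?_, fun i' hi' => ?_, fun j' hj' => ?_⟩
    · rw [hCle i j hj.le, hBlt i j hj]; exact h1
    · rw [hCle i' j hj.le, hBlt i' j hj]; exact h2 i' hi'
    · rw [hC, hBk i hii₀, zero_mul, ite_self, add_zero, hBrow i hik]; exact h3 j' hj'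
  · refine ⟨i₀, ?_, fun i' hi' => ?_, fun j' hj' => ?_⟩
    · rw [hCle i₀ j le_rfl, hBi₀]; exact hp
    · rw [hCle i' j le_rfl]; exact hBk i' hi'
    · rcases lt_or_gt_of_ne hj' with h | h
      · rw [hCle i₀ j' h.le, hBi₀, hrow j' h]
      · rw [hC, if_pos h, hBi₀, hBi₀]
        simp only [y]; field_simp; ring

/-- The Bruhat decomposition: every double coset of `N_n(K)` in `GL_n(K)` contains a monomial
matrix. -/
theorem exists_monomial (g : GL (Fin n) K) :
    ∃ u ∈ unipotent n K, ∃ u' ∈ unipotent n K, ∃ σ : Equiv.Perm (Fin n), ∃ t : Fin n → K,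
      (∀ j, t j ≠ 0) ∧ ∀ i j, (u * g * u').1 i j = if i = σ j then t j else 0 := by
  have key : ∀ k : ℕ, k ≤ n → ∃ u ∈ unipotent n K, ∃ u' ∈ unipotent n K,
      ∀ j : Fin n, j.val < k → ∃ i, IsPivot (u * g * u') i j := by
    intro k
    induction k with
    | zero => exact fun _ => ⟨1, one_mem _, 1, one_mem _, fun j hj => absurd hj (Nat.not_lt_zero _)⟩
    | succ k ih =>
      intro hk
      obtain ⟨u, hu, u', hu', h⟩ := ih (by omega)
      obtain ⟨v, hv, v', hv', h'⟩ := exists_pivot_step (u * g * u') ⟨k, by omega⟩ h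
      refine ⟨v * u, mul_mem hv hu, u' * v', mul_mem hu' hv', fun j hj => ?_⟩
      obtain ⟨i, hi⟩ := h' j (by rw [Fin.le_def]; simp only; omega)
      exact ⟨i, by simpa only [mul_assoc] using hi⟩
  obtain ⟨u, hu, u', hu', h⟩ := key n le_rfl
  choose s hs using fun j : Fin n => h j j.isLt
  have hinj : Function.Injective s := by
    intro j j' hjj
    by_contra hne
    exact (hs j).1 (hjj ▸ (hs j').2.2 j hne)
  refine ⟨u, hu, u', hu', Equiv.ofBijective s (Finite.injective_iff_bijective.mp hinj),
    fun j => (u * g * u').1 (s j) j, fun j => (hs j).1, fun i j => ?_⟩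
  rw [Equiv.ofBijective_apply]
  split_ifs with hij
  · rw [hij]
  · exact (hs j).2.1 i hij

/-- A permutation of an initial segment of `ℕ` all of whose descents are by one is a product of
reversals of consecutive intervals; in particular it is an involution. A function that does not
change at the descents is invariant under it. -/
theorem perm_involutive_of_descents {α : Type*} (ρ : Equiv.Perm (Fin n)) (t : Fin n → α)
    (h : ∀ c d : Fin n, d.val = c.val + 1 → ρ d < ρ c → (ρ c).val = (ρ d).val + 1 ∧ t c = t d)
    (c : Fin n) : ρ (ρ c) = c ∧ t (ρ c) = t c := by
  let P : ℕ → Prop := fun k => ∀ j : Fin n, j.val < k →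
    (ρ j).val < k ∧ ρ (ρ j) = j ∧ t (ρ j) = t j
  have step : ∀ k, k < n → P k → ∃ k', k < k' ∧ P k' := by
    intro k hk hP
    -- the interval `[k, m]` with `ρ m = k` is reversed
    let k₀ : Fin n := ⟨k, hk⟩
    let m : Fin n := ρ.symm k₀
    have hm : ρ m = k₀ := ρ.apply_symm_apply k₀
    have hge : ∀ j : Fin n, k ≤ j.val → k ≤ (ρ j).val := by
      intro j hj
      by_contra! hlt
      obtain ⟨h1, h2, -⟩ := hP (ρ j) hlt
      have := ρ.injective h2
      omega
    have hmk : k ≤ m.val := by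
      by_contra! hlt
      have := (hP m hlt).1
      rw [hm] at this
      exact lt_irrefl _ this
    have hrev : ∀ i : ℕ, k + i ≤ m.val → ∀ j : Fin n, j.val + i = m.val →
        (ρ j).val = k + i ∧ t j = t m := by
      intro i
      induction i using Nat.strong_induction_on with
      | _ i ih =>
        intro hi j hj
        rcases Nat.eq_zero_or_pos i with rfl | hpos
        · have : j = m := Fin.ext (by omega)
          rw [this, hm]
          exact ⟨rfl, rfl⟩
        · have hd : j.val + 1 < n := by have := m.isLt; omega
          obtain ⟨h1, h2⟩ := ih (i - 1) (by omega) (by omega) ⟨j.val + 1, hd⟩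
            (by simp only; omega)
          have hlow := hge j (by omega)
          have hne : k + (i - 1) < (ρ j).val := by
            by_contra! hle
            have hlt : (ρ j).val - k < i := by omega
            have hb : m.val - ((ρ j).val - k) < n := by have := m.isLt; omega
            have h3 := (ih ((ρ j).val - k) hlt (by omega) ⟨m.val - ((ρ j).val - k), hb⟩
              (by simp only; omega)).1
            have h4 := ρ.injective (Fin.ext (by rw [h3]; omega) :
              ρ ⟨m.val - ((ρ j).val - k), hb⟩ = ρ j)
            have h5 := congrArg Fin.val h4
            simp only at h5
            omega
          obtain ⟨h6, h7⟩ := h j ⟨j.val + 1, hd⟩ rfl (by rw [Fin.lt_def, h1]; exact hne)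
          exact ⟨by rw [h6, h1]; omega, h7.trans h2⟩
    refine ⟨m.val + 1, by omega, fun j hj => ?_⟩
    rcases lt_or_ge j.val k with hjk | hjk
    · have := hP j hjk
      exact ⟨by omega, this.2⟩
    · obtain ⟨h1, h2⟩ := hrev (m.val - j.val) (by omega) j (by omega)
      obtain ⟨h3, h4⟩ := hrev (j.val - k) (by omega) (ρ j) (by omega)
      exact ⟨by omega, Fin.ext (by omega), by rw [h4, h2]⟩
  have main : ∀ d k, k + d = n → P k → P n := by
    intro d
    induction d using Nat.strong_induction_on with
    | _ d ih =>
      intro k hk hP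
      rcases Nat.eq_zero_or_pos d with rfl | hd
      · have : k = n := by omega
        exact this ▸ hP
      · obtain ⟨k', h1, h2⟩ := step k (by omega) hP
        rcases le_or_gt k' n with h3 | h3
        · exact ih (n - k') (by omega) k' (by omega) h2
        · intro j hj
          exact ⟨(ρ j).isLt, (h2 j (by omega)).2⟩
  exact (main n 0 (by omega) (fun j hj => absurd hj (Nat.not_lt_zero _)) c c.isLt).2

/-- The anti-involution `g ↦ w_n ᵗg w_n` of `GL_n`, the reflection in the antidiagonal. -/
def antiTranspose (g : GL (Fin n) K) : GL (Fin n) K where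
  val := Matrix.of fun i j => g.1 (Fin.rev j) (Fin.rev i)
  inv := Matrix.of fun i j => (g⁻¹).1 (Fin.rev j) (Fin.rev i)
  val_inv := by
    ext i j
    have h : (g⁻¹ * g).1 j.rev i.rev = (1 : Matrix (Fin n) (Fin n) K) i j := by
      rw [inv_mul_cancel, Units.val_one, Matrix.one_apply, Matrix.one_apply]
      simp [eq_comm]
    rw [← h, Units.val_mul, Matrix.mul_apply, Matrix.mul_apply, ← Equiv.sum_comp Fin.revPerm]
    simp [mul_comm]
  inv_val := by
    ext i j
    have h : (g * g⁻¹).1 j.rev i.rev = (1 : Matrix (Fin n) (Fin n) K) i j := by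
      rw [mul_inv_cancel, Units.val_one, Matrix.one_apply, Matrix.one_apply]
      simp [eq_comm]
    rw [← h, Units.val_mul, Matrix.mul_apply, Matrix.mul_apply, ← Equiv.sum_comp Fin.revPerm]
    simp [mul_comm]

theorem antiTranspose_apply (g : GL (Fin n) K) (i j : Fin n) :
    (antiTranspose g).1 i j = g.1 (Fin.rev j) (Fin.rev i) := rfl

theorem antiTranspose_mul (g h : GL (Fin n) K) :
    antiTranspose (g * h) = antiTranspose h * antiTranspose g := by
  apply Units.ext
  ext i j
  rw [antiTranspose_apply, Units.val_mul, Units.val_mul, Matrix.mul_apply, Matrix.mul_apply,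
    ← Equiv.sum_comp Fin.revPerm]
  simp [antiTranspose_apply, mul_comm]

@[simp]
theorem antiTranspose_antiTranspose (g : GL (Fin n) K) : antiTranspose (antiTranspose g) = g := by
  apply Units.ext
  ext i j
  simp [antiTranspose_apply]

theorem antiTranspose_mem {u : GL (Fin n) K} (hu : u ∈ unipotent n K) :
    antiTranspose u ∈ unipotent n K :=
  ⟨fun _ _ hij => hu.1 _ _ (Fin.rev_lt_rev.mpr hij), fun _ => hu.2 _⟩

theorem superdiagChar_antiTranspose (ψ : AddChar K ℂ) (u : GL (Fin n) K) :
    superdiagChar ψ (antiTranspose u) = superdiagChar ψ u := by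
  rw [superdiagChar, superdiagChar, Finset.sum_comm, ← Equiv.sum_comp Fin.revPerm]
  congr 1
  refine Finset.sum_congr rfl fun i _ => ?_
  rw [← Equiv.sum_comp Fin.revPerm]
  refine Finset.sum_congr rfl fun j _ => ?_
  have : (Fin.rev i).val = (Fin.rev j).val + 1 ↔ j.val = i.val + 1 := by
    rw [Fin.val_rev, Fin.val_rev]; omega
  simp only [Fin.revPerm_apply, antiTranspose_apply, Fin.rev_rev, this]

/-- Functions `f` on `GL_n(K)` with `f(u g) = ψ(u) f(g) = f(g u)` for all `u ∈ N_n(K)`. -/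
def IsBiequivariant (ψ : AddChar K ℂ) (f : GL (Fin n) K → ℂ) : Prop :=
  ∀ u ∈ unipotent n K, ∀ g, f (u * g) = superdiagChar ψ u * f g ∧
    f (g * u) = superdiagChar ψ u * f g

theorem IsBiequivariant.comp_antiTranspose {ψ : AddChar K ℂ} {f : GL (Fin n) K → ℂ}
    (hf : IsBiequivariant ψ f) : IsBiequivariant ψ (f ∘ antiTranspose) := by
  intro u hu g
  have := hf _ (antiTranspose_mem hu) (antiTranspose g)
  simp only [Function.comp, antiTranspose_mul, this, superdiagChar_antiTranspose, and_self]

theorem exists_apply_ne_one {ψ : AddChar K ℂ} (hψ : ψ ≠ 1) : ∃ x, ψ x ≠ 1 := by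
  by_contra! h
  exact hψ (by ext x; simp [h])

/-- A monomial matrix in the support of a bi-equivariant function is symmetric with respect to the
antidiagonal: comparing the two actions of the simple root subgroups shows that the permutation
`j ↦ rev (σ j)` has descents only by one, along which the entries are constant. -/
theorem antiTranspose_eq_of_monomial {ψ : AddChar K ℂ} (hψ : ψ ≠ 1) {f : GL (Fin n) K → ℂ}
    (hf : IsBiequivariant ψ f) {m : GL (Fin n) K} {σ : Equiv.Perm (Fin n)} {t : Fin n → K}
    (ht : ∀ j, t j ≠ 0) (hm : ∀ i j, m.1 i j = if i = σ j then t j else 0) (hfm : f m ≠ 0) :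
    antiTranspose m = m := by
  have key : ∀ c d : Fin n, d.val = c.val + 1 → σ c < σ d →
      (σ d).val = (σ c).val + 1 ∧ t c = t d := by
    intro c d hcd hlt
    have hrel : ∀ x : K, m * colUnipotent d (Pi.single c x) =
        colUnipotent (σ d) (Pi.single (σ c) (x * (t c / t d))) * m := by
      intro x
      apply Units.ext
      ext i j
      have hcd' : c < d := by rw [Fin.lt_def]; omega
      rw [mul_colUnipotent_apply, colUnipotent_mul_apply, hm (σ d) j, Finset.sum_eq_single c]
      · rw [if_pos hcd', Pi.single_eq_same, hm i c]
        by_cases h1 : i = σ c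
        · subst h1
          by_cases h2 : j = d
          · subst h2
            simp only [if_true, if_pos hlt, Pi.single_eq_same]
            have := ht j
            field_simp
          · simp [h2, Ne.symm h2]
        · simp [h1]
      · intro l _ hl
        simp [hl]
      · simp
    have hval : ∀ x : K, ψ x =
        superdiagChar ψ (colUnipotent (σ d) (Pi.single (σ c) (x * (t c / t d)))) := by
      intro x
      have h1 := (hf _ (colUnipotent_mem d (Pi.single c x)) m).2
      have h2 := (hf _ (colUnipotent_mem (σ d) (Pi.single (σ c) (x * (t c / t d)))) m).1
      rw [hrel, h2] at h1
      rw [mul_right_cancel₀ hfm h1, superdiagChar_colUnipotent ψ hcd, Pi.single_eq_same]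
    have hsucc : (σ d).val = (σ c).val + 1 := by
      by_contra hne
      obtain ⟨x, hx⟩ := exists_apply_ne_one hψ
      refine hx ((hval x).trans ?_)
      have hr : (σ d).val = (σ d).val - 1 + 1 := by rw [Fin.lt_def] at hlt; omega
      rw [superdiagChar_colUnipotent ψ (r := ⟨(σ d).val - 1, by omega⟩) hr, Pi.single_eq_of_ne,
        AddChar.map_zero_eq_one]
      intro h
      rw [Fin.ext_iff] at h
      simp only at h
      omega
    refine ⟨hsucc, ?_⟩
    by_contra hne
    have hψ' : ∀ x, ψ (x * (1 - t c / t d)) = 1 := by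
      intro x
      have := hval x
      rw [superdiagChar_colUnipotent ψ hsucc, Pi.single_eq_same] at this
      rw [mul_sub, mul_one, sub_eq_add_neg, AddChar.map_add_eq_mul, AddChar.map_neg_eq_inv, ← this,
        mul_inv_cancel₀ (AddChar.val_isUnit ψ _).ne_zero]
    have h1 : 1 - t c / t d ≠ 0 := by
      rw [sub_ne_zero]
      intro h
      rw [eq_comm, div_eq_one_iff_eq (ht d)] at h
      exact hne h
    obtain ⟨x, hx⟩ := exists_apply_ne_one hψ
    refine hx ?_
    have := hψ' (x / (1 - t c / t d))
    rwa [div_mul_cancel₀ _ h1] at this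
  have hρ := perm_involutive_of_descents (σ.trans Fin.revPerm) t fun c d hcd hlt => by
    simp only [Equiv.trans_apply, Fin.revPerm_apply, Fin.rev_lt_rev, Fin.val_rev] at hlt ⊢
    obtain ⟨h1, h2⟩ := key c d hcd hlt
    exact ⟨by omega, h2⟩
  simp only [Equiv.trans_apply, Fin.revPerm_apply] at hρ
  apply Units.ext
  ext i j
  rw [antiTranspose_apply, hm, hm]
  by_cases h : i = σ j
  · subst h
    have := hρ j
    rw [if_pos rfl, if_pos (by rw [← this.1, Fin.rev_rev, this.1]), this.2]
  · rw [if_neg h, if_neg]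
    intro h'
    apply h
    have := (hρ (Fin.rev i)).1
    rw [← h', Fin.rev_rev] at this
    rw [← Fin.rev_rev i, ← this, Fin.rev_rev]

/-- Bi-equivariant functions are invariant under the anti-involution `g ↦ w_n ᵗg w_n`. -/
theorem IsBiequivariant.apply_antiTranspose {ψ : AddChar K ℂ} (hψ : ψ ≠ 1) {f : GL (Fin n) K → ℂ}
    (hf : IsBiequivariant ψ f) (g : GL (Fin n) K) : f (antiTranspose g) = f g := by
  obtain ⟨u, hu, u', hu', σ, t, ht, hm⟩ := exists_monomial g
  have h1 : f (antiTranspose (u * g * u')) = f (u * g * u') := by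
    by_cases h : f (u * g * u') = 0
    · by_cases h' : (f ∘ antiTranspose) (u * g * u') = 0
      · rw [h]; exact h'
      · rw [antiTranspose_eq_of_monomial hψ hf.comp_antiTranspose ht hm h']
    · rw [antiTranspose_eq_of_monomial hψ hf ht hm h]
  have h2 := (hf.comp_antiTranspose u' hu' (u * g)).2
  rw [(hf.comp_antiTranspose u hu g).1] at h2
  simp only [Function.comp] at h2
  rw [h2, (hf u' hu' _).2, (hf u hu g).1] at h1
  exact mul_left_cancel₀ (superdiagChar_ne_zero ψ u)
    (mul_left_cancel₀ (superdiagChar_ne_zero ψ u') h1)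

end Bruhat

/-! ### Whittaker vectors in cuspidal representations -/

section Whittaker

variable {n : ℕ} {E V : Type*} [Field E] [AddCommGroup V] [Module ℂ V]

/-- The vectors `v` with `π(u) v = ψ(u) v` for all `u ∈ N_n(E)`. -/
def whittakerVectors (π : Representation ℂ (GL (Fin n) E) V) (ψ : AddChar E ℂ) :
    Submodule ℂ V where
  carrier := {v | ∀ u ∈ unipotent n E, π u v = superdiagChar ψ u • v}
  add_mem' := fun ha hb u hu => by rw [map_add, ha u hu, hb u hu, smul_add]
  zero_mem' := fun u _ => by rw [map_zero, smul_zero]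
  smul_mem' := fun c v hv u hu => by rw [map_smul, hv u hu, smul_comm]

theorem rep_mul_apply {G : Type*} [Monoid G] (π : Representation ℂ G V) (g h : G) (v : V) :
    π (g * h) v = π g (π h v) := by
  rw [map_mul, Module.End.mul_apply]

theorem IsColTail.exists_eq_mul {c : Fin n} {u : GL (Fin n) E} (hu : IsColTail c.val u) :
    ∃ h, IsColTail (c.val + 1) h ∧ u = colUnipotent c (fun i => u.1 i c) * h := by
  refine ⟨(colUnipotent c fun i => u.1 i c)⁻¹ * u, ⟨mul_mem (inv_mem (colUnipotent_mem _ _)) hu.1,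
    fun i j hj => ?_⟩, (mul_inv_cancel_left _ _).symm⟩
  rw [← colUnipotent_neg, colUnipotent_mul_apply, Pi.neg_apply]
  rcases lt_or_eq_of_le (Nat.lt_succ_iff.mp hj) with h | h
  · rw [hu.1.1 c j h, mul_zero, ite_self, add_zero, hu.2 i j h]
  · obtain rfl : j = c := Fin.ext h
    rw [hu.1.2 j]
    split_ifs with hi
    · rw [Matrix.one_apply_ne (ne_of_lt hi)]; ring
    · rcases eq_or_lt_of_le (not_lt.mp hi) with rfl | hi'
      · rw [hu.1.2 j, Matrix.one_apply_eq, add_zero]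
      · rw [hu.1.1 i j hi', Matrix.one_apply_ne (ne_of_gt hi'), add_zero]

theorem colUnipotent_mul_eq {r c : Fin n} (hrc : c.val = r.val + 1) {g : GL (Fin n) E}
    (hg : ∀ i j, r < i ∨ r < j → g.1 i j = (1 : Matrix (Fin n) (Fin n) E) i j) (x : Fin n → E) :
    ∃ z : Fin n → E, colUnipotent c x * g = g * colUnipotent c z ∧ ∑ l, g.1 r l * z l = x r := by
  let x' : Fin n → E := fun i => if i < c then x i else 0
  let z : Fin n → E := (g⁻¹).1 *ᵥ x'
  have hgz : ∀ i, ∑ l, g.1 i l * z l = x' i := by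
    intro i
    have : (g.1 *ᵥ z) i = x' i := by
      rw [Matrix.mulVec_mulVec, ← Units.val_mul, mul_inv_cancel, Units.val_one, Matrix.one_mulVec]
    rw [← this]; rfl
  have hlt : ∀ i : Fin n, i < c ↔ ¬ r < i := by
    intro i; rw [Fin.lt_def, Fin.lt_def]; omega
  have hz : ∀ l, ¬ l < c → z l = 0 := by
    intro l hl
    have h := hgz l
    rw [Finset.sum_eq_single l, hg l l (Or.inl (by rw [hlt] at hl; exact not_not.mp hl)),
      Matrix.one_apply_eq, one_mul] at h
    · rw [h]; exact if_neg hl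
    · intro j _ hj
      rw [hg l j (Or.inl (by rw [hlt] at hl; exact not_not.mp hl)),
        Matrix.one_apply_ne (Ne.symm hj), zero_mul]
    · simp
  refine ⟨z, ?_, (hgz r).trans (if_pos (by rw [Fin.lt_def]; omega))⟩
  apply Units.ext
  ext i j
  rw [mul_colUnipotent_apply, colUnipotent_mul_apply,
    hg c j (Or.inl (by rw [Fin.lt_def]; omega))]
  have : ∑ l, g.1 i l * (if l < c then z l else 0) = x' i := by
    rw [← hgz i]
    refine Finset.sum_congr rfl fun l _ => ?_
    split_ifs with h
    · rfl
    · rw [hz l h]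
  rw [this]
  congr 1
  by_cases h : j = c
  · subst h; simp [x']
  · simp [h, Matrix.one_apply_ne (Ne.symm h)]

theorem sum_addChar_dotProduct [Fintype E] [DecidableEq E] {ψ : AddChar E ℂ} (hψ : ψ ≠ 1)
    (x : Fin n → E) :
    ∑ y : Fin n → E, ψ (x ⬝ᵥ y) =
      if x = 0 then (Fintype.card E : ℂ) ^ n else 0 := by
  split_ifs with h
  · simp [h]
  · obtain ⟨i, hi⟩ := Function.ne_iff.mp h
    let χ : AddChar (Fin n → E) ℂ :=
      ⟨fun y => ψ (x ⬝ᵥ y), by simp, fun a b => by rw [dotProduct_add, AddChar.map_add_eq_mul]⟩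
    have : χ ≠ 0 := by
      intro h0
      obtain ⟨a, ha⟩ := exists_apply_ne_one hψ
      refine ha ?_
      have := DFunLike.congr_fun h0 (Pi.single i (a / x i))
      simp only [χ, AddChar.coe_mk, dotProduct_single, AddChar.zero_apply] at this
      rwa [mul_div_cancel₀ _ hi] at this
    exact AddChar.sum_eq_zero_iff_ne_zero.mpr this

/-- Fourier analysis in one column: an equivariant vector for the columns of index `> c` yields one
for the columns of index `≥ c`. The trivial character of the column of index `c` does not contribute
by cuspidality, and the other ones are conjugate under the mirabolic subgroup. -/
theorem exists_colTail_step [Finite E] {ψ : AddChar E ℂ} (hψ : ψ ≠ 1)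
    {π : Representation ℂ (GL (Fin n) E) V} (hcusp : IsCuspidal π) {S : Submodule ℂ V}
    (hS : ∀ p ∈ tailUnipotent n (n - 1) E, ∀ v ∈ S, π p v ∈ S) {c : Fin n} (hc : 0 < c.val)
    (h : ∃ v ∈ S, v ≠ 0 ∧ ∀ u, IsColTail (c.val + 1) u → π u v = superdiagChar ψ u • v) :
    ∃ v ∈ S, v ≠ 0 ∧ ∀ u, IsColTail c.val u → π u v = superdiagChar ψ u • v := by
  classical
  have := Fintype.ofFinite E
  obtain ⟨v, hvS, hv0, hv⟩ := h
  have hr : c.val - 1 < n := by omega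
  let r : Fin n := ⟨c.val - 1, hr⟩
  have hrc : c.val = r.val + 1 := by simp only [r]; omega
  let w : (Fin n → E) → V := fun y => ∑ x : Fin n → E, ψ (-(y ⬝ᵥ x)) • π (colUnipotent c x) v
  have hwS : ∀ y, w y ∈ S := fun y => Submodule.sum_mem _ fun x _ => Submodule.smul_mem _ _
    (hS _ (unipotent_le_tailUnipotent _ (colUnipotent_mem c x)) v hvS)
  have hwH : ∀ y u, IsColTail (c.val + 1) u → π u (w y) = superdiagChar ψ u • w y := by
    intro y u hu
    simp only [w, map_sum, map_smul, Finset.smul_sum]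
    refine Finset.sum_congr rfl fun x _ => ?_
    have hx := unipotent_le_tailUnipotent c.val (colUnipotent_mem c x)
    have e : u * colUnipotent c x =
        colUnipotent c x * ((colUnipotent c x)⁻¹ * u * colUnipotent c x) := by group
    rw [← rep_mul_apply, e, rep_mul_apply, hv _ (hu.conj hx), superdiagChar_conj ψ hu hx,
      map_smul, smul_comm]
  have hwC : ∀ y z, π (colUnipotent c z) (w y) = ψ (y ⬝ᵥ z) • w y := by
    intro y z
    simp only [w, map_sum, map_smul, Finset.smul_sum]
    rw [← Equiv.sum_comp (Equiv.addLeft z) (fun x => ψ (y ⬝ᵥ z) • ψ (-(y ⬝ᵥ x)) •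
      π (colUnipotent c x) v)]
    refine Finset.sum_congr rfl fun x _ => ?_
    rw [← rep_mul_apply, ← colUnipotent_add, Equiv.coe_addLeft, smul_smul,
      ← AddChar.map_add_eq_mul, dotProduct_add]
    congr 2
    ring
  have hsum : ∑ y, w y = ((Fintype.card E : ℂ) ^ n) • v := by
    simp only [w]
    rw [Finset.sum_comm]
    have : ∀ x : Fin n → E, ∑ y : Fin n → E, ψ (-(y ⬝ᵥ x)) • π (colUnipotent c x) v =
        if x = 0 then ((Fintype.card E : ℂ) ^ n) • v else 0 := by
      intro x
      have h1 := sum_addChar_dotProduct hψ (-x)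
      simp only [neg_dotProduct, neg_eq_zero] at h1
      rw [← Finset.sum_smul]
      simp only [dotProduct_comm _ x, h1]
      split_ifs with hx
      · rw [hx, colUnipotent_zero, map_one, Module.End.one_apply]
      · rw [zero_smul]
    simp only [this]
    simp
  obtain ⟨y, hy⟩ : ∃ y, w y ≠ 0 := by
    by_contra! h0
    rw [Finset.sum_eq_zero (fun y _ => h0 y), eq_comm, smul_eq_zero] at hsum
    rcases hsum with h1 | h1
    · exact pow_ne_zero n (Nat.cast_ne_zero.mpr Fintype.card_ne_zero) h1
    · exact hv0 h1
  have hysupp : ∀ i, r < i → y i = 0 := by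
    intro i hi
    by_contra hyi
    obtain ⟨a, ha⟩ := exists_apply_ne_one hψ
    have h1 : colUnipotent c (Pi.single i (a / y i)) = 1 := by
      apply Units.ext
      ext k l
      rw [colUnipotent_apply, Units.val_one]
      by_cases hk : k = i
      · rw [if_neg, add_zero]
        rintro ⟨-, h2⟩
        rw [hk, Fin.lt_def] at h2
        rw [Fin.lt_def] at hi
        omega
      · simp [hk]
    have h2 := hwC y (Pi.single i (a / y i))
    rw [h1, map_one, Module.End.one_apply, dotProduct_single, mul_div_cancel₀ _ hyi] at h2
    have h3 : (1 - ψ a) • w y = 0 := by rw [sub_smul, one_smul, ← h2, sub_self]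
    rcases smul_eq_zero.mp h3 with h4 | h4
    · exact ha (sub_eq_zero.mp h4).symm
    · exact hy h4
  by_cases hy0 : y = 0
  · -- the trivial character is excluded by cuspidality
    refine absurd (hcusp c.val hc c.isLt (w y) fun u hu => ?_) hy
    have huN : u ∈ unipotent n E := by
      refine ⟨fun i j hij => ?_, fun i => ?_⟩
      · rw [hu i j (by rw [Fin.lt_def] at hij; omega), Matrix.one_apply_ne (ne_of_gt hij)]
      · rw [hu i i (by omega), Matrix.one_apply_eq]
    have huT : IsColTail c.val u := ⟨huN, fun i j hj => hu i j (by omega)⟩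
    obtain ⟨h, hh, hdec⟩ := huT.exists_eq_mul
    have hχ : superdiagChar ψ h = 1 := by
      have h1 := superdiagChar_mul ψ (colUnipotent_mem c fun i => u.1 i c) hh.1
      rw [← hdec, superdiagChar_colUnipotent ψ hrc] at h1
      have h2 : superdiagChar ψ u = ψ (u.1 r c) := by
        rw [superdiagChar, Finset.sum_eq_single r, Finset.sum_eq_single c, if_pos hrc]
        · intro j _ hj
          rw [if_neg fun h => hj (Fin.ext (h.trans hrc.symm))]
        · simp
        · intro i _ hi
          refine Finset.sum_eq_zero fun j _ => ?_
          split_ifs with hj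
          · have := Fin.val_ne_of_ne hi
            rw [hu i j (by omega), Matrix.one_apply_ne (fun e => by rw [e] at hj; omega)]
          · rfl
        · simp
      rw [h2] at h1
      exact (mul_eq_left₀ (AddChar.val_isUnit ψ _).ne_zero).mp h1.symm
    rw [hdec, rep_mul_apply, hwH _ _ hh, hχ, one_smul, hwC, hy0, zero_dotProduct,
      AddChar.map_zero_eq_one, one_smul]
  · obtain ⟨g, hg, hgy⟩ := exists_row_eq r y hysupp hy0
    have hgT : g ∈ tailUnipotent n c.val E := by
      intro i hi
      have hri : r < i := by rw [Fin.lt_def]; omega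
      exact ⟨fun j hj => by rw [hg i j (Or.inl hri), Matrix.one_apply_ne (ne_of_gt hj)],
        by rw [hg i i (Or.inl hri), Matrix.one_apply_eq]⟩
    have hc' := c.isLt
    refine ⟨π g (w y), hS g (tailUnipotent_mono (by omega) hgT) _ (hwS y), ?_, fun u hu => ?_⟩
    · intro h0
      apply hy
      rw [← Module.End.one_apply (R := ℂ) (w y), ← map_one π, ← inv_mul_cancel g, rep_mul_apply,
        h0, map_zero]
    · obtain ⟨h, hh, hdec⟩ := hu.exists_eq_mul
      have hhg : π h (π g (w y)) = superdiagChar ψ h • π g (w y) := by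
        have e : h * g = g * (g⁻¹ * h * g) := by group
        rw [← rep_mul_apply, e, rep_mul_apply, hwH _ _ (hh.conj hgT), superdiagChar_conj ψ hh hgT,
          map_smul]
      obtain ⟨z, hz, hzr⟩ := colUnipotent_mul_eq hrc hg fun i => u.1 i c
      have hyz : y ⬝ᵥ z = u.1 r c := by
        rw [← hzr]
        exact Finset.sum_congr rfl fun l _ => by rw [hgy]
      have h1 := superdiagChar_mul ψ (colUnipotent_mem c fun i => u.1 i c) hh.1
      rw [← hdec, superdiagChar_colUnipotent ψ hrc] at h1
      rw [h1]
      conv_lhs => rw [hdec]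
      rw [rep_mul_apply, hhg, map_smul, ← rep_mul_apply, hz, rep_mul_apply, hwC, hyz, map_smul,
        smul_smul, mul_comm]

/-- Every non-zero subspace of a cuspidal representation that is stable under the mirabolic subgroup
contains a non-zero Whittaker vector. -/
theorem exists_whittakerVector [Finite E] {ψ : AddChar E ℂ} (hψ : ψ ≠ 1)
    {π : Representation ℂ (GL (Fin n) E) V} (hcusp : IsCuspidal π) {S : Submodule ℂ V}
    (hS : ∀ p ∈ tailUnipotent n (n - 1) E, ∀ v ∈ S, π p v ∈ S) (hne : S ≠ ⊥) :
    ∃ v ∈ S, v ≠ 0 ∧ v ∈ whittakerVectors π ψ := by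
  have key : ∀ d k : ℕ, 0 < k → k + d = n →
      ∃ v ∈ S, v ≠ 0 ∧ ∀ u, IsColTail k u → π u v = superdiagChar ψ u • v := by
    intro d
    induction d with
    | zero =>
      intro k _ hk
      obtain ⟨v, hvS, hv0⟩ := Submodule.exists_mem_ne_zero_of_ne_bot hne
      refine ⟨v, hvS, hv0, fun u hu => ?_⟩
      have : u = 1 := by
        apply Units.ext
        ext i j
        exact hu.2 i j (by omega)
      rw [this, superdiagChar_one, one_smul, map_one, Module.End.one_apply]
    | succ d ih =>
      intro k hk hkn
      exact exists_colTail_step hψ hcusp hS (c := ⟨k, by omega⟩) hk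
        (ih (k + 1) (by omega) (by omega))
  rcases Nat.eq_zero_or_pos n with hn | hn
  · subst hn
    obtain ⟨v, hvS, hv0⟩ := Submodule.exists_mem_ne_zero_of_ne_bot hne
    refine ⟨v, hvS, hv0, fun u _ => ?_⟩
    rw [Subsingleton.elim u 1, superdiagChar_one, one_smul, map_one, Module.End.one_apply]
  · obtain ⟨v, hvS, hv0, hv⟩ := key (n - 1) 1 one_pos (by omega)
    refine ⟨v, hvS, hv0, fun u hu => hv u ⟨hu, fun i j hj => ?_⟩⟩
    rcases lt_or_eq_of_le (Fin.le_def.mpr (by omega : j.val ≤ i.val)) with h | h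
    · rw [hu.1 i j h, Matrix.one_apply_ne (ne_of_gt h)]
    · rw [h, hu.2 i, Matrix.one_apply_eq]

/-! ### Uniqueness of Whittaker models -/

theorem span_orbit_eq_top {G : Type*} [Monoid G] {π : Representation ℂ G V}
    (hirr : π.IsIrreducible) {v : V} (hv : v ≠ 0) :
    Submodule.span ℂ (Set.range fun g => π g v) = ⊤ := by
  let S : Subrepresentation π := ⟨Submodule.span ℂ (Set.range fun g => π g v), by
    intro g w hw
    induction hw using Submodule.span_induction with
    | mem x hx =>
      obtain ⟨h, rfl⟩ := hx
      exact Submodule.subset_span ⟨g * h, rep_mul_apply π g h v⟩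
    | zero => rw [map_zero]; exact zero_mem _
    | add x y _ _ hx hy => rw [map_add]; exact add_mem hx hy
    | smul a x _ hx => rw [map_smul]; exact Submodule.smul_mem _ _ hx⟩
  have hvS : v ∈ S.toSubmodule :=
    Submodule.subset_span ⟨1, by simp only [map_one, Module.End.one_apply]⟩
  rcases hirr.eq_bot_or_eq_top S with h | h
  · rw [h] at hvS
    exact absurd ((Submodule.mem_bot ℂ).mp hvS) hv
  · exact congrArg Subrepresentation.toSubmodule h

theorem finiteDimensional_of_irreducible {G : Type*} [Monoid G] [Finite G]
    {π : Representation ℂ G V} (hirr : π.IsIrreducible) : FiniteDimensional ℂ V := by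
  by_cases h : ∃ v : V, v ≠ 0
  · obtain ⟨v, hv⟩ := h
    exact ⟨span_orbit_eq_top hirr hv ▸ Submodule.fg_span (Set.finite_range _)⟩
  · push Not at h
    have : Subsingleton V := ⟨fun a b => (h a).trans (h b).symm⟩
    infer_instance

theorem exists_ne_zero_of_irreducible {G : Type*} [Monoid G] {π : Representation ℂ G V}
    (hirr : π.IsIrreducible) : ∃ v : V, v ≠ 0 := by
  by_contra! h
  obtain ⟨S, T, hST⟩ := hirr.toNontrivial
  refine hST (Subrepresentation.toSubmodule_injective ?_)
  ext v
  rw [h v]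
  exact ⟨fun _ => zero_mem _, fun _ => zero_mem _⟩

variable [Fintype (unipotent n E)]

/-- The projection `|N|⁻¹ ∑_{u ∈ N} ψ(u)⁻¹ π(u)` onto the Whittaker vectors. -/
def whittakerProj (π : Representation ℂ (GL (Fin n) E) V) (ψ : AddChar E ℂ) : V →ₗ[ℂ] V :=
  (Fintype.card (unipotent n E) : ℂ)⁻¹ •
    ∑ u : unipotent n E, (superdiagChar ψ u.1)⁻¹ • π u.1

theorem whittakerProj_apply (π : Representation ℂ (GL (Fin n) E) V) (ψ : AddChar E ℂ) (v : V) :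
    whittakerProj π ψ v = (Fintype.card (unipotent n E) : ℂ)⁻¹ •
      ∑ u : unipotent n E, (superdiagChar ψ u.1)⁻¹ • π u.1 v := by
  simp [whittakerProj]

theorem whittakerProj_mem (π : Representation ℂ (GL (Fin n) E) V) (ψ : AddChar E ℂ) (v : V) :
    whittakerProj π ψ v ∈ whittakerVectors π ψ := by
  intro u hu
  rw [whittakerProj_apply, map_smul, smul_comm]
  congr 1
  rw [map_sum, Finset.smul_sum, ← Equiv.sum_comp (Equiv.mulLeft (⟨u, hu⟩ : unipotent n E))
    (fun x => superdiagChar ψ u • (superdiagChar ψ x.1)⁻¹ • π x.1 v)]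
  refine Finset.sum_congr rfl fun x _ => ?_
  rw [map_smul, ← rep_mul_apply, smul_smul]
  simp only [Equiv.coe_mulLeft, Subgroup.coe_mul, superdiagChar_mul ψ hu x.2]
  rw [mul_inv, mul_inv_cancel_left₀ (superdiagChar_ne_zero ψ u)]

theorem whittakerProj_apply_of_mem {π : Representation ℂ (GL (Fin n) E) V} {ψ : AddChar E ℂ}
    {v : V} (hv : v ∈ whittakerVectors π ψ) : whittakerProj π ψ v = v := by
  rw [whittakerProj_apply]
  have : ∀ u : unipotent n E, (superdiagChar ψ u.1)⁻¹ • π u.1 v = v := fun u => by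
    rw [hv u.1 u.2, smul_smul, inv_mul_cancel₀ (superdiagChar_ne_zero ψ _), one_smul]
  simp only [this]
  rw [Finset.sum_const, Finset.card_univ, ← Nat.cast_smul_eq_nsmul ℂ, smul_smul,
    inv_mul_cancel₀ (Nat.cast_ne_zero.mpr Fintype.card_ne_zero), one_smul]

theorem whittakerProj_rep (π : Representation ℂ (GL (Fin n) E) V) (ψ : AddChar E ℂ)
    {u : GL (Fin n) E} (hu : u ∈ unipotent n E) (v : V) :
    whittakerProj π ψ (π u v) = superdiagChar ψ u • whittakerProj π ψ v := by
  rw [whittakerProj_apply, whittakerProj_apply, smul_comm]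
  congr 1
  rw [Finset.smul_sum, ← Equiv.sum_comp (Equiv.mulRight (⟨u, hu⟩ : unipotent n E))
    (fun x => superdiagChar ψ u • (superdiagChar ψ x.1)⁻¹ • π x.1 v)]
  refine Finset.sum_congr rfl fun x _ => ?_
  rw [← rep_mul_apply, smul_smul]
  simp only [Equiv.coe_mulRight, Subgroup.coe_mul, superdiagChar_mul ψ x.2 hu]
  rw [mul_inv_rev, mul_inv_cancel_left₀ (superdiagChar_ne_zero ψ u)]

theorem IsWhittakerFunctional.apply_whittakerProj {π : Representation ℂ (GL (Fin n) E) V}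
    {ψ : AddChar E ℂ} {l : Module.Dual ℂ V} (hl : IsWhittakerFunctional π ψ l) (v : V) :
    l (whittakerProj π ψ v) = l v := by
  rw [whittakerProj_apply, map_smul, map_sum]
  have : ∀ u : unipotent n E, l ((superdiagChar ψ u.1)⁻¹ • π u.1 v) = l v := fun u => by
    rw [map_smul, hl u.1 u.2, smul_eq_mul, inv_mul_cancel_left₀ (superdiagChar_ne_zero ψ _)]
  simp only [this]
  rw [Finset.sum_const, Finset.card_univ, nsmul_eq_mul, smul_eq_mul,
    inv_mul_cancel_left₀ (Nat.cast_ne_zero.mpr Fintype.card_ne_zero)]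

/-- The operators `e π(g) e`, with `e` the projection onto the Whittaker vectors, have
bi-equivariant matrix coefficients. -/
theorem isBiequivariant_coeff (π : Representation ℂ (GL (Fin n) E) V) (ψ : AddChar E ℂ)
    (l : Module.Dual ℂ V) {w : V} (hw : w ∈ whittakerVectors π ψ) :
    IsBiequivariant ψ fun g => l (whittakerProj π ψ (π g w)) := by
  intro u hu g
  simp only [rep_mul_apply, whittakerProj_rep π ψ hu, hw u hu, map_smul, smul_eq_mul, and_self]

theorem whittakerProj_antiTranspose {π : Representation ℂ (GL (Fin n) E) V} {ψ : AddChar E ℂ}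
    (hψ : ψ ≠ 1) {w : V} (hw : w ∈ whittakerVectors π ψ) (g : GL (Fin n) E) :
    whittakerProj π ψ (π (antiTranspose g) w) = whittakerProj π ψ (π g w) := by
  rw [← sub_eq_zero, ← Module.forall_dual_apply_eq_zero_iff ℂ]
  intro l
  rw [map_sub, sub_eq_zero]
  exact (isBiequivariant_coeff π ψ l hw).apply_antiTranspose hψ g

/-- Gelfand's trick: the operators `e π(g) e` commute, because `g ↦ w_n ᵗg w_n` reverses
products. -/
theorem whittakerProj_comm {π : Representation ℂ (GL (Fin n) E) V} {ψ : AddChar E ℂ}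
    (hψ : ψ ≠ 1) {w : V} (hw : w ∈ whittakerVectors π ψ) (g h : GL (Fin n) E) :
    whittakerProj π ψ (π g (whittakerProj π ψ (π h w))) =
      whittakerProj π ψ (π h (whittakerProj π ψ (π g w))) := by
  have expand : ∀ a b : GL (Fin n) E, whittakerProj π ψ (π a (whittakerProj π ψ (π b w))) =
      (Fintype.card (unipotent n E) : ℂ)⁻¹ • ∑ u : unipotent n E, (superdiagChar ψ u.1)⁻¹ •
        whittakerProj π ψ (π (a * u.1 * b) w) := by
    intro a b
    rw [whittakerProj_apply π ψ (π b w)]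
    simp only [map_smul, map_sum, rep_mul_apply]
  let ι : unipotent n E ≃ unipotent n E :=
    ⟨fun u => ⟨antiTranspose u.1, antiTranspose_mem u.2⟩,
      fun u => ⟨antiTranspose u.1, antiTranspose_mem u.2⟩, fun u => by simp, fun u => by simp⟩
  have h1 : whittakerProj π ψ (π g (whittakerProj π ψ (π h w))) =
      whittakerProj π ψ (π (antiTranspose h)
        (whittakerProj π ψ (π (antiTranspose g) w))) := by
    rw [expand, expand]
    congr 1
    rw [← Equiv.sum_comp ι (fun u => (superdiagChar ψ u.1)⁻¹ •
        whittakerProj π ψ (π (antiTranspose h * u.1 * antiTranspose g) w))]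
    refine Finset.sum_congr rfl fun u _ => ?_
    rw [← whittakerProj_antiTranspose hψ hw (g * u.1 * h)]
    simp only [ι, Equiv.coe_fn_mk, superdiagChar_antiTranspose, antiTranspose_mul, mul_assoc]
  rw [h1, whittakerProj_antiTranspose hψ hw,
    whittakerProj_antiTranspose hψ (whittakerProj_mem π ψ _)]

/-- Multiplicity one for Whittaker vectors: the commuting operators `e π(g) e` act irreducibly on
the space of Whittaker vectors. -/
theorem mem_span_of_mem_whittakerVectors [Finite E] {π : Representation ℂ (GL (Fin n) E) V}
    (hirr : π.IsIrreducible) {ψ : AddChar E ℂ} (hψ : ψ ≠ 1) {v₀ v : V}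
    (hv₀ : v₀ ∈ whittakerVectors π ψ) (h0 : v₀ ≠ 0) (hv : v ∈ whittakerVectors π ψ) :
    v ∈ Submodule.span ℂ {v₀} := by
  have := finiteDimensional_of_irreducible hirr
  have hscalar : ∀ h : GL (Fin n) E, ∃ μ : ℂ, whittakerProj π ψ (π h v₀) = μ • v₀ := by
    intro h
    let T : Module.End ℂ (whittakerVectors π ψ) :=
      (whittakerProj π ψ ∘ₗ π h).restrict fun w _ => whittakerProj_mem π ψ _
    have : Nontrivial (whittakerVectors π ψ) :=
      ⟨⟨v₀, hv₀⟩, 0, fun h => h0 (congrArg Subtype.val h)⟩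
    obtain ⟨μ, hμ⟩ := Module.End.exists_eigenvalue T
    obtain ⟨w, hw⟩ := hμ.exists_hasEigenvector
    have hw1 : whittakerProj π ψ (π h w.1) = μ • w.1 := congrArg Subtype.val hw.apply_eq_smul
    have hw0 : w.1 ≠ 0 := fun h => hw.2 (Subtype.ext h)
    refine ⟨μ, ?_⟩
    have hmem : v₀ ∈ Submodule.span ℂ (Set.range fun g => π g w.1) := by
      rw [span_orbit_eq_top hirr hw0]; trivial
    rw [← whittakerProj_apply_of_mem hv₀]
    clear_value T
    clear hv₀ h0
    induction hmem using Submodule.span_induction with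
    | mem x hx =>
      obtain ⟨g, rfl⟩ := hx
      simp only
      rw [whittakerProj_comm hψ w.2, hw1, map_smul, map_smul]
    | zero => simp
    | add x y _ _ hx hy => simp only [map_add, smul_add, hx, hy]
    | smul a x _ hx => simp only [map_smul, hx, smul_comm a μ]
  have hmem : v ∈ Submodule.span ℂ (Set.range fun g => π g v₀) := by
    rw [span_orbit_eq_top hirr h0]; trivial
  rw [← whittakerProj_apply_of_mem hv]
  clear hv
  induction hmem using Submodule.span_induction with
  | mem x hx =>
    obtain ⟨g, rfl⟩ := hx
    obtain ⟨μ, hμ⟩ := hscalar g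
    simp only [hμ]
    exact Submodule.smul_mem _ _ (Submodule.mem_span_singleton_self v₀)
  | zero => rw [map_zero]; exact zero_mem _
  | add x y _ _ hx hy => rw [map_add]; exact add_mem hx hy
  | smul a x _ hx => rw [map_smul]; exact Submodule.smul_mem _ _ hx

end Whittaker

/-! ### Contragredient representations and Whittaker functionals -/

section Dual

variable {n : ℕ} {E V : Type*} [Field E] [AddCommGroup V] [Module ℂ V]

theorem dual_apply_apply {G : Type*} [Group G] (π : Representation ℂ G V) (g : G)
    (l : Module.Dual ℂ V) (v : V) : π.dual g l v = l (π g⁻¹ v) := rfl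

theorem isIrreducible_dual {G : Type*} [Group G] [Finite G] {π : Representation ℂ G V}
    (hirr : π.IsIrreducible) : π.dual.IsIrreducible := by
  have := finiteDimensional_of_irreducible hirr
  obtain ⟨v, hv⟩ := exists_ne_zero_of_irreducible hirr
  obtain ⟨l, hl⟩ : ∃ l : Module.Dual ℂ V, l v ≠ 0 := by
    by_contra! h
    exact hv ((Module.forall_dual_apply_eq_zero_iff ℂ v).mp h)
  have hnt : Nontrivial (Subrepresentation π.dual) := by
    refine ⟨⊥, ⊤, fun h => hl ?_⟩
    have h1 : l ∈ (⊥ : Subrepresentation π.dual).toSubmodule := by rw [h]; trivial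
    rw [(Submodule.mem_bot ℂ).mp h1, LinearMap.zero_apply]
  refine ⟨fun T => ?_⟩
  let S : Subrepresentation π := ⟨T.toSubmodule.dualCoannihilator, by
    intro g w hw
    rw [Submodule.mem_dualCoannihilator] at hw ⊢
    intro φ hφ
    have := hw _ (T.apply_mem_toSubmodule g⁻¹ hφ)
    rwa [dual_apply_apply, inv_inv] at this⟩
  have hT : T.toSubmodule = S.toSubmodule.dualAnnihilator :=
    (Subspace.dualCoannihilator_dualAnnihilator_eq).symm
  rcases hirr.eq_bot_or_eq_top S with h | h
  · right
    apply Subrepresentation.toSubmodule_injective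
    rw [hT, h]
    exact Submodule.dualAnnihilator_bot
  · left
    apply Subrepresentation.toSubmodule_injective
    rw [hT, h]
    exact Submodule.dualAnnihilator_top

theorem isCuspidal_dual [Finite E] {π : Representation ℂ (GL (Fin n) E) V}
    (hcusp : IsCuspidal π) : IsCuspidal π.dual := by
  classical
  have := Fintype.ofFinite E
  intro k hk hkn l hl
  let U : Finset (GL (Fin n) E) := Finset.univ.filter fun u =>
    ∀ i j : Fin n, ¬(i.val < k ∧ k ≤ j.val) → u.1 i j = (1 : Matrix (Fin n) (Fin n) E) i j
  have hU : ∀ u, u ∈ U ↔ ∀ i j : Fin n, ¬(i.val < k ∧ k ≤ j.val) →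
      u.1 i j = (1 : Matrix (Fin n) (Fin n) E) i j := fun u => by simp [U]
  have hmul : ∀ a ∈ U, ∀ b ∈ U, a * b ∈ U := by
    intro a ha b hb
    rw [hU] at *
    intro i j hij
    rw [Units.val_mul, Matrix.mul_apply]
    rcases lt_or_ge i.val k with hi | hi
    · simp only [hb _ j (fun h => hij ⟨hi, h.2⟩)]
      rw [← Matrix.mul_apply, mul_one, ha i j hij]
    · simp only [ha i _ (fun h => absurd h.1 (not_lt.mpr hi))]
      rw [← Matrix.mul_apply, one_mul, hb i j hij]
  ext v
  have hfix : ∑ u ∈ U, π u v = 0 := by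
    refine hcusp k hk hkn _ fun a ha => ?_
    have hmap : U.map (mulLeftEmbedding a) = U := by
      refine Finset.eq_of_subset_of_card_le (fun x hx => ?_) (by rw [Finset.card_map])
      obtain ⟨b, hb, rfl⟩ := Finset.mem_map.mp hx
      exact hmul a ((hU a).mpr ha) b hb
    conv_rhs => rw [← hmap]
    rw [Finset.sum_map, map_sum]
    exact Finset.sum_congr rfl fun x _ => (rep_mul_apply π a x v).symm
  have h1 : ∀ u ∈ U, l (π u v) = l v := by
    intro u hu
    have h2 := hl u ((hU u).mp hu)
    have h3 : π.dual u⁻¹ l = l := by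
      conv_lhs => rw [← h2]
      rw [← rep_mul_apply, inv_mul_cancel, map_one, Module.End.one_apply]
    have h4 : π.dual u⁻¹ l v = l (π u v) := by rw [dual_apply_apply, inv_inv]
    rw [← h4, h3]
  have h2 : l (∑ u ∈ U, π u v) = (U.card : ℂ) * l v := by
    rw [map_sum, Finset.sum_congr rfl h1, Finset.sum_const, nsmul_eq_mul]
  rw [hfix, map_zero, eq_comm, mul_eq_zero] at h2
  refine h2.resolve_left (Nat.cast_ne_zero.mpr (Finset.card_ne_zero.mpr ⟨1, ?_⟩))
  rw [hU]
  exact fun i j _ => rfl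

theorem mem_whittakerVectors_dual {π : Representation ℂ (GL (Fin n) E) V} {ψ : AddChar E ℂ}
    {l : Module.Dual ℂ V} :
    l ∈ whittakerVectors π.dual ψ⁻¹ ↔ IsWhittakerFunctional π ψ l := by
  constructor
  · intro h u hu v
    have := congrArg (fun m : Module.Dual ℂ V => m v) (h u⁻¹ (inv_mem hu))
    simp only [dual_apply_apply, inv_inv, superdiagChar_inv_char, superdiagChar_inv ψ hu,
      LinearMap.smul_apply, smul_eq_mul] at this
    exact this
  · intro h u hu
    ext v
    rw [dual_apply_apply, h _ (inv_mem hu), superdiagChar_inv ψ hu, superdiagChar_inv_char,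
      LinearMap.smul_apply, smul_eq_mul]

theorem isWhittakerFunctional_dual_eval {π : Representation ℂ (GL (Fin n) E) V} {ψ : AddChar E ℂ}
    {v : V} (hv : v ∈ whittakerVectors π ψ) :
    IsWhittakerFunctional π.dual ψ⁻¹ (Module.Dual.eval ℂ V v) := by
  intro u hu l
  rw [Module.Dual.eval_apply, Module.Dual.eval_apply, dual_apply_apply, hv _ (inv_mem hu),
    map_smul, superdiagChar_inv ψ hu, superdiagChar_inv_char, smul_eq_mul]

/-- `l` is a Whittaker functional and `v` a Whittaker vector of `π`, with `l(v) = 1`; the function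
`g ↦ l(π(g) v)` is then the Bessel function of `π`. -/
structure IsWhittakerPair (π : Representation ℂ (GL (Fin n) E) V) (ψ : AddChar E ℂ)
    (l : Module.Dual ℂ V) (v : V) : Prop where
  functional : IsWhittakerFunctional π ψ l
  vector : v ∈ whittakerVectors π ψ
  normalized : l v = 1

theorem IsWhittakerPair.dual {π : Representation ℂ (GL (Fin n) E) V} {ψ : AddChar E ℂ}
    {l : Module.Dual ℂ V} {v : V} (h : IsWhittakerPair π ψ l v) :
    IsWhittakerPair π.dual ψ⁻¹ (Module.Dual.eval ℂ V v) l :=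
  ⟨isWhittakerFunctional_dual_eval h.vector, mem_whittakerVectors_dual.mpr h.functional,
    h.normalized⟩

theorem IsWhittakerPair.ne_zero {π : Representation ℂ (GL (Fin n) E) V} {ψ : AddChar E ℂ}
    {l : Module.Dual ℂ V} {v : V} (h : IsWhittakerPair π ψ l v) : v ≠ 0 := by
  rintro rfl
  simpa using h.normalized

variable [Finite E] {π : Representation ℂ (GL (Fin n) E) V} {ψ : AddChar E ℂ}

theorem inv_char_ne_one {R : Type*} [CommRing R] {ψ : AddChar R ℂ} (hψ : ψ ≠ 1) : ψ⁻¹ ≠ 1 :=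
  inv_ne_one.mpr hψ

theorem exists_isWhittakerPair (hirr : π.IsIrreducible) (hcusp : IsCuspidal π) (hψ : ψ ≠ 1) :
    ∃ l v, IsWhittakerPair π ψ l v := by
  have := Fintype.ofFinite (unipotent n E)
  obtain ⟨m, hm⟩ := exists_ne_zero_of_irreducible (isIrreducible_dual hirr)
  obtain ⟨l, -, hl0, hl⟩ := exists_whittakerVector (inv_char_ne_one hψ) (isCuspidal_dual hcusp)
    (S := ⊤) (fun _ _ _ _ => trivial) ((Submodule.ne_bot_iff _).mpr ⟨m, trivial, hm⟩)
  rw [mem_whittakerVectors_dual] at hl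
  obtain ⟨v, hv⟩ : ∃ v, l v ≠ 0 := by
    by_contra! h
    exact hl0 (LinearMap.ext h)
  refine ⟨l, (l v)⁻¹ • whittakerProj π ψ v, hl,
    Submodule.smul_mem _ _ (whittakerProj_mem π ψ v), ?_⟩
  rw [map_smul, hl.apply_whittakerProj, smul_eq_mul, inv_mul_cancel₀ hv]

theorem IsWhittakerFunctional.apply_eq_zero (hirr : π.IsIrreducible) (hψ : ψ ≠ 1)
    {m : Module.Dual ℂ V} (hm : IsWhittakerFunctional π ψ m) {v : V}
    (hv : v ∈ whittakerVectors π ψ) (hv0 : v ≠ 0) (hmv : m v = 0) : m = 0 := by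
  have := Fintype.ofFinite (unipotent n E)
  ext w
  obtain ⟨a, ha⟩ := Submodule.mem_span_singleton.mp
    (mem_span_of_mem_whittakerVectors hirr hψ hv hv0 (whittakerProj_mem π ψ w))
  rw [← hm.apply_whittakerProj, ← ha, map_smul, hmv, smul_zero, LinearMap.zero_apply]

/-- Uniqueness of Whittaker functionals. -/
theorem IsWhittakerPair.functional_eq (hirr : π.IsIrreducible) (hψ : ψ ≠ 1)
    {l : Module.Dual ℂ V} {v : V} (h : IsWhittakerPair π ψ l v) {m : Module.Dual ℂ V}
    (hm : IsWhittakerFunctional π ψ m) : m = m v • l := by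
  rw [← sub_eq_zero]
  refine IsWhittakerFunctional.apply_eq_zero hirr hψ (fun u hu w => ?_) h.vector h.ne_zero ?_
  · simp only [LinearMap.sub_apply, LinearMap.smul_apply, hm u hu, h.functional u hu, smul_eq_mul]
    ring
  · simp [h.normalized]

theorem mem_whittakerModel_iff (hirr : π.IsIrreducible) (hψ : ψ ≠ 1)
    {l : Module.Dual ℂ V} {v : V} (h : IsWhittakerPair π ψ l v) {W : GL (Fin n) E → ℂ} :
    W ∈ whittakerModel π ψ ↔ ∃ w, W = fun g => l (π g w) := by
  constructor
  · intro hW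
    induction hW using Submodule.span_induction with
    | mem x hx =>
      obtain ⟨m, hm, w, rfl⟩ := hx
      refine ⟨m v • w, ?_⟩
      funext g
      rw [h.functional_eq hirr hψ hm]
      simp [h.normalized]
    | zero => exact ⟨0, by funext g; simp⟩
    | add x y _ _ hx hy =>
      obtain ⟨a, rfl⟩ := hx
      obtain ⟨b, rfl⟩ := hy
      exact ⟨a + b, by funext g; simp⟩
    | smul c x _ hx =>
      obtain ⟨a, rfl⟩ := hx
      exact ⟨c • a, by funext g; simp⟩
  · rintro ⟨w, rfl⟩
    exact Submodule.subset_span ⟨l, h.functional, w, rfl⟩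

/-- A Whittaker vector of an irreducible cuspidal representation generates it under the mirabolic
subgroup: otherwise, a Whittaker functional would vanish on the Whittaker vectors. -/
theorem span_mirabolic_orbit (hirr : π.IsIrreducible) (hcusp : IsCuspidal π) (hψ : ψ ≠ 1) {v : V}
    (hv : v ∈ whittakerVectors π ψ) (hv0 : v ≠ 0) :
    Submodule.span ℂ {w | ∃ p ∈ tailUnipotent n (n - 1) E, w = π p v} = ⊤ := by
  have := finiteDimensional_of_irreducible hirr
  set S := Submodule.span ℂ {w | ∃ p ∈ tailUnipotent n (n - 1) E, w = π p v} with hS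
  have hstab : ∀ p ∈ tailUnipotent n (n - 1) E, ∀ w ∈ S, π p w ∈ S := by
    intro p hp w hw
    induction hw using Submodule.span_induction with
    | mem x hx =>
      obtain ⟨q, hq, rfl⟩ := hx
      exact Submodule.subset_span ⟨p * q, mul_mem hp hq, (rep_mul_apply π p q v).symm⟩
    | zero => rw [map_zero]; exact zero_mem _
    | add x y _ _ hx hy => rw [map_add]; exact add_mem hx hy
    | smul a x _ hx => rw [map_smul]; exact Submodule.smul_mem _ _ hx
  by_contra hne
  obtain ⟨m, hmS, hm0, hm⟩ := exists_whittakerVector (inv_char_ne_one hψ) (isCuspidal_dual hcusp)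
    (S := S.dualAnnihilator) (fun p hp l hl => by
      rw [Submodule.mem_dualAnnihilator] at hl ⊢
      exact fun w hw => hl _ (hstab _ (inv_mem hp) w hw))
    (fun h => hne ((Subspace.dualAnnihilator_inj (W' := ⊤)).mp
      (h.trans Submodule.dualAnnihilator_top.symm)))
  refine hm0 (IsWhittakerFunctional.apply_eq_zero hirr hψ (mem_whittakerVectors_dual.mp hm) hv hv0
    ((Submodule.mem_dualAnnihilator m).mp hmS v (Submodule.subset_span ⟨1, one_mem _, ?_⟩)))
  rw [map_one, Module.End.one_apply]

end Dual

/-! ### Supports on the mirabolic subgroup -/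

section Support

variable {n : ℕ} {F E V : Type*} [Field F] [Field E] [Algebra F E]

theorem eq_zero_of_char_mul {ψ : AddChar E ℂ} (hψ : ψ ≠ 1) {x y : E}
    (h : ∀ a, ψ (x * a) = ψ (y * a)) : x = y := by
  by_contra hne
  obtain ⟨b, hb⟩ := exists_apply_ne_one hψ
  apply hb
  have := h (b / (x - y))
  rw [← mul_div_cancel₀ b (sub_ne_zero.mpr hne), sub_mul, sub_eq_add_neg, AddChar.map_add_eq_mul,
    AddChar.map_neg_eq_inv, this, mul_inv_cancel₀ (AddChar.val_isUnit ψ _).ne_zero]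

/-- On the mirabolic subgroup, bi-equivariant functions are supported on `N_n(E)`. -/
theorem IsBiequivariant.mem_unipotent {ψ : AddChar E ℂ} (hψ : ψ ≠ 1) {f : GL (Fin n) E → ℂ}
    (hf : IsBiequivariant ψ f) {p : GL (Fin n) E} (hp : p ∈ tailUnipotent n (n - 1) E)
    (hfp : f p ≠ 0) : p ∈ unipotent n E := by
  have key : ∀ k : ℕ, k ≤ n - 1 → p ∈ tailUnipotent n k E → p ∈ unipotent n E := by
    intro k
    induction k with
    | zero => exact fun _ h => tailUnipotent_zero (n := n) (K := E) ▸ h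
    | succ k ih =>
      intro hk hpk
      refine ih (by omega) fun i hi => ?_
      rcases lt_or_eq_of_le hi with hi | hi
      · exact hpk i hi
      · let c : Fin n := ⟨k + 1, by omega⟩
        have hic : c.val = i.val + 1 := by simp only [c]; omega
        have hrow : ∀ j, j ≤ i → p.1 i j = (1 : Matrix (Fin n) (Fin n) E) i j := by
          intro j hj
          refine eq_zero_of_char_mul hψ fun a => ?_
          have hjc : j < c := by rw [Fin.lt_def]; rw [Fin.le_def] at hj; omega
          have h1 := (hf _ (colUnipotent_mem c (Pi.single j a)) p).2
          have h2 := (hf _ (conj_colUnipotent_mem (c := c) hpk (Pi.single j a)) p).1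
          rw [inv_mul_cancel_right, h1, superdiagChar_colUnipotent ψ hic,
            superdiagChar_conj_colUnipotent ψ hic (p := p) hpk] at h2
          rw [Finset.sum_eq_single j] at h2
          · rw [if_pos hjc, Pi.single_eq_same] at h2
            rw [← mul_right_cancel₀ hfp h2]
            congr 1
            by_cases hij : i = j
            · subst hij; simp
            · simp [hij]
          · intro l _ hl
            simp [hl]
          · simp
        exact ⟨fun j hj => by rw [hrow j hj.le, Matrix.one_apply_ne (ne_of_gt hj)],
          by rw [hrow i le_rfl, Matrix.one_apply_eq]⟩
  exact key (n - 1) le_rfl hp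

theorem baseGL_apply (g : GL (Fin n) F) (i j : Fin n) :
    (baseGL n F E g).1 i j = algebraMap F E (g.1 i j) := rfl

theorem baseGL_mem {k : ℕ} {g : GL (Fin n) F} (hg : g ∈ tailUnipotent n k F) :
    baseGL n F E g ∈ tailUnipotent n k E := fun i hi =>
  ⟨fun j hj => by rw [baseGL_apply, (hg i hi).1 j hj, map_zero],
    by rw [baseGL_apply, (hg i hi).2, map_one]⟩

theorem baseGL_mem_unipotent_iff {g : GL (Fin n) F} :
    baseGL n F E g ∈ unipotent n E ↔ g ∈ unipotent n F := by
  simp only [mem_unipotent, baseGL_apply, map_eq_zero, map_eq_one_iff _ (algebraMap F E).injective]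

theorem superdiagChar_baseGL {ψ : AddChar E ℂ} (hψF : ∀ x : F, ψ (algebraMap F E x) = 1)
    (u : GL (Fin n) F) : superdiagChar ψ (baseGL n F E u) = 1 := by
  rw [superdiagChar]
  simp only [baseGL_apply]
  rw [← hψF (∑ i : Fin n, ∑ j : Fin n, if j.val = i.val + 1 then u.1 i j else 0)]
  simp only [map_sum]
  congr 2
  funext i
  congr 1
  funext j
  split_ifs
  · rfl
  · rw [map_zero]

/-- For a quadratic extension `E / F`, the annihilator of `F` under a non-trivial character of `E`
that is trivial on `F` is `F`. -/
theorem mem_range_of_char_mul_eq_one (hE : Module.finrank F E = 2) {ψ : AddChar E ℂ} (hψ : ψ ≠ 1)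
    (hψF : ∀ x : F, ψ (algebraMap F E x) = 1) {x : E}
    (hx : ∀ t : F, ψ (x * algebraMap F E t) = 1) : ∃ y : F, algebraMap F E y = x := by
  have := Module.finite_of_finrank_pos (by rw [hE]; exact two_pos : 0 < Module.finrank F E)
  by_contra! hne
  have hli : LinearIndependent F ![(1 : E), x] := by
    rw [LinearIndependent.pair_iff]
    intro s t hst
    have ht : t = 0 := by
      by_contra ht
      refine hne (-(s / t)) ?_
      rw [Algebra.smul_def, Algebra.smul_def, mul_one] at hst
      have ht' : algebraMap F E t ≠ 0 := by simpa using ht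
      rw [map_neg, map_div₀]
      field_simp
      linear_combination (-1 : E) * hst
    subst ht
    simpa using hst
  have hspan := hli.span_eq_top_of_card_eq_finrank' (by simp [hE])
  refine hψ ?_
  ext e
  have he : e ∈ Submodule.span F (Set.range ![(1 : E), x]) := by rw [hspan]; trivial
  rw [Matrix.range_cons, Matrix.range_cons, Matrix.range_empty, Set.union_empty,
    Set.singleton_union, Submodule.mem_span_pair] at he
  obtain ⟨a, b, rfl⟩ := he
  rw [AddChar.map_add_eq_mul, Algebra.smul_def, mul_one, hψF, Algebra.smul_def, mul_comm,
    mul_comm _ x, hx]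
  simp

/-- A function on the mirabolic subgroup of `GL_n(E)` that is `(N_n(E), ψ)`-equivariant on the left
and invariant under the mirabolic subgroup of `GL_n(F)` on the right is determined by its value at
the identity: row by row, a matrix in its support can be moved into `N_n(E)`. -/
theorem eq_zero_of_equivariant_of_invariant (hE : Module.finrank F E = 2) {ψ : AddChar E ℂ}
    (hψ : ψ ≠ 1) (hψF : ∀ x : F, ψ (algebraMap F E x) = 1) {f : GL (Fin n) E → ℂ}
    (hfN : ∀ u ∈ unipotent n E, ∀ p, f (u * p) = superdiagChar ψ u * f p)
    (hfP : ∀ h ∈ tailUnipotent n (n - 1) F, ∀ p, f (p * baseGL n F E h) = f p) (hf1 : f 1 = 0)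
    {p : GL (Fin n) E} (hp : p ∈ tailUnipotent n (n - 1) E) : f p = 0 := by
  classical
  have key : ∀ k : ℕ, k ≤ n - 1 → ∀ p ∈ tailUnipotent n k E, f p = 0 := by
    intro k
    induction k with
    | zero =>
      intro _ p hp
      rw [tailUnipotent_zero] at hp
      rw [← mul_one p, hfN p hp, hf1, mul_zero]
    | succ k ih =>
      intro hk p hp
      by_contra hfp
      let r : Fin n := ⟨k, by omega⟩
      let c : Fin n := ⟨k + 1, by omega⟩
      have hrc : c.val = r.val + 1 := rfl
      have hlt : ∀ j : Fin n, j < c ↔ ¬ r < j := by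
        intro j; rw [Fin.lt_def, Fin.lt_def]; omega
      have hrat : ∀ j, j < c → ∃ y : F, algebraMap F E y = p.1 r j := by
        intro j hj
        refine mem_range_of_char_mul_eq_one hE hψ hψF fun t => ?_
        have hbase : baseGL n F E (colUnipotent c (Pi.single j t)) =
            colUnipotent c (Pi.single j (algebraMap F E t)) := by
          apply Units.ext
          ext a b
          rw [baseGL_apply, colUnipotent_apply, colUnipotent_apply, map_add, Matrix.one_apply,
            Matrix.one_apply]
          congr 1
          · split_ifs <;> simp
          · by_cases ha : a = j
            · subst ha; split_ifs <;> simp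
            · simp [ha]
        have h1 := hfP _ (unipotent_le_tailUnipotent _ (colUnipotent_mem c (Pi.single j t))) p
        have h2 := hfN _ (conj_colUnipotent_mem (c := c) hp (Pi.single j (algebraMap F E t))) p
        rw [inv_mul_cancel_right, ← hbase, h1, hbase,
          superdiagChar_conj_colUnipotent ψ hrc (p := p) hp, Finset.sum_eq_single j, if_pos hj,
          Pi.single_eq_same] at h2
        · exact (mul_eq_right₀ hfp).mp h2.symm
        · intro l _ hl
          simp [hl]
        · simp
      choose! y₀ hy₀ using hrat
      let y : Fin n → F := fun j => if j < c then y₀ j else 0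
      have hyp : ∀ j, j < c → algebraMap F E (y j) = p.1 r j := by
        intro j hj
        simp only [y, if_pos hj, hy₀ j hj]
      have hp' := inv_mem hp
      have hy0 : y ≠ 0 := by
        intro h0
        have h1 : (p * p⁻¹).1 r r = 1 := by simp
        rw [Units.val_mul, Matrix.mul_apply, Finset.sum_eq_zero] at h1
        · exact zero_ne_one h1
        · intro l _
          by_cases hl : l < c
          · rw [← hyp l hl, h0, Pi.zero_apply, map_zero, zero_mul]
          · rw [(hp' l (not_lt.mp hl)).1 r (by rw [hlt, not_not] at hl; exact hl), mul_zero]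
      obtain ⟨g, hg, hgy⟩ := exists_row_eq r y
        (fun i hi => if_neg (by rw [hlt, not_not]; exact hi)) hy0
      have hgT : g ∈ tailUnipotent n (k + 1) F := by
        intro i hi
        have hri : r < i := Fin.lt_def.mpr hi
        exact ⟨fun j hj => by rw [hg i j (Or.inl hri), Matrix.one_apply_ne (ne_of_gt hj)],
          by rw [hg i i (Or.inl hri), Matrix.one_apply_eq]⟩
      have hgT' := inv_mem hgT
      have hq : p * baseGL n F E g⁻¹ ∈ tailUnipotent n (k + 1) E := mul_mem hp (baseGL_mem hgT')
      have hrow : ∀ j, j ≤ r → (p * baseGL n F E g⁻¹).1 r j =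
          algebraMap F E ((1 : Matrix (Fin n) (Fin n) F) r j) := by
        intro j hj
        have h1 : ((g * g⁻¹).1 r j : F) = (1 : Matrix (Fin n) (Fin n) F) r j := by
          rw [mul_inv_cancel, Units.val_one]
        rw [← h1, Units.val_mul, Units.val_mul, Matrix.mul_apply, Matrix.mul_apply, map_sum]
        refine Finset.sum_congr rfl fun l _ => ?_
        rw [baseGL_apply, map_mul]
        by_cases hl : l < c
        · rw [hgy, hyp l hl]
        · rw [hlt, not_not] at hl
          rw [(hgT' l (Fin.lt_def.mp hl)).1 j (lt_of_le_of_lt hj hl), map_zero, mul_zero, mul_zero]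
      refine hfp ?_
      rw [← hfP _ (tailUnipotent_mono hk hgT') p]
      refine ih (by omega) _ fun i hi => ?_
      rcases lt_or_eq_of_le hi with hi | hi
      · exact hq i hi
      · obtain rfl : i = r := Fin.ext hi.symm
        exact ⟨fun j hj => by rw [hrow j hj.le, Matrix.one_apply_ne (ne_of_gt hj), map_zero],
          by rw [hrow _ le_rfl, Matrix.one_apply_eq, map_one]⟩
  exact key (n - 1) le_rfl p hp

/-- A functional on an irreducible cuspidal representation of `GL_n(E)` that is invariant under the
mirabolic subgroup of `GL_n(F)` is determined by its value at a Whittaker vector. -/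
theorem functional_eq_zero_of_invariant [Finite E] [AddCommGroup V] [Module ℂ V]
    {π : Representation ℂ (GL (Fin n) E) V} (hirr : π.IsIrreducible) (hcusp : IsCuspidal π)
    (hE : Module.finrank F E = 2) {ψ : AddChar E ℂ} (hψ : ψ ≠ 1)
    (hψF : ∀ x : F, ψ (algebraMap F E x) = 1) {v : V} (hv : v ∈ whittakerVectors π ψ) (hv0 : v ≠ 0)
    {L : Module.Dual ℂ V}
    (hL : ∀ p ∈ tailUnipotent n (n - 1) F, ∀ w, L (π (baseGL n F E p) w) = L w) (hLv : L v = 0) :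
    L = 0 := by
  ext w
  have hw : w ∈ Submodule.span ℂ {w | ∃ p ∈ tailUnipotent n (n - 1) E, w = π p v} := by
    rw [span_mirabolic_orbit hirr hcusp hψ hv hv0]; trivial
  induction hw using Submodule.span_induction with
  | mem x hx =>
    obtain ⟨p, hp, rfl⟩ := hx
    have := eq_zero_of_equivariant_of_invariant hE (inv_char_ne_one hψ)
      (fun x => by rw [AddChar.inv_apply, AddChar.map_neg_eq_inv, hψF, inv_one])
      (f := fun q => L (π q⁻¹ v)) (fun u hu q => by
        simp only [mul_inv_rev, rep_mul_apply, hv _ (inv_mem hu), map_smul, smul_eq_mul,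
          superdiagChar_inv ψ hu, superdiagChar_inv_char])
      (fun h hh q => by
        simp only [mul_inv_rev, rep_mul_apply]
        rw [← map_inv, hL _ (inv_mem hh)])
      (by simpa using hLv) (inv_mem hp)
    simpa using this
  | zero => simp
  | add x y _ _ hx hy => simp only [map_add, hx, hy]
  | smul a x _ hx => simp only [map_smul, hx]

end Support

/-! ### Flicker sums -/

section CosetSum

variable {n : ℕ} {F : Type*} [Field F]

theorem cosetSum_add [Finite F] (f g : GL (Fin n) F → ℂ) :
    cosetSum (fun x => f x + g x) = cosetSum f + cosetSum g :=
  finsum_add_distrib (Set.toFinite _) (Set.toFinite _)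

theorem cosetSum_const_mul [Finite F] (c : ℂ) (f : GL (Fin n) F → ℂ) :
    cosetSum (fun x => c * f x) = c * cosetSum f :=
  (mul_finsum _ _).symm

theorem cosetSum_conj [Finite F] (f : GL (Fin n) F → ℂ) :
    cosetSum (fun x => starRingEnd ℂ (f x)) = starRingEnd ℂ (cosetSum f) :=
  ((starRingEnd ℂ).toAddMonoidHom.map_finsum (Set.toFinite _)).symm

theorem cosetSum_eq_zero {f : GL (Fin n) F → ℂ} (hf : ∀ g, f g = 0) : cosetSum f = 0 := by
  simp [cosetSum, hf]

/-- The sum over the cosets of `N_n(F)` is the sum over the group divided by the order of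
`N_n(F)`. -/
theorem card_mul_cosetSum [Fintype (GL (Fin n) F)] [Fintype (unipotent n F)]
    {f : GL (Fin n) F → ℂ} (hf : ∀ u ∈ unipotent n F, ∀ g, f (u * g) = f g) :
    (Fintype.card (unipotent n F) : ℂ) * cosetSum f = ∑ g, f g := by
  classical
  have := Fintype.ofFinite (Quotient (QuotientGroup.rightRel (unipotent n F)))
  rw [cosetSum, finsum_eq_sum_of_fintype, Finset.mul_sum,
    ← Finset.sum_fiberwise Finset.univ
      (fun g => (Quotient.mk'' g : Quotient (QuotientGroup.rightRel (unipotent n F)))) f]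
  refine Finset.sum_congr rfl fun x _ => ?_
  have hfib : (Finset.univ.filter fun g : GL (Fin n) F =>
      (Quotient.mk'' g : Quotient (QuotientGroup.rightRel (unipotent n F))) = x) =
      (Finset.univ : Finset (unipotent n F)).map
        ((Function.Embedding.subtype _).trans (mulRightEmbedding x.out)) := by
    ext g
    simp only [Finset.mem_filter, Finset.mem_univ, true_and, Finset.mem_map,
      Function.Embedding.trans_apply, Function.Embedding.subtype_apply, mulRightEmbedding_apply]
    have h1 : (Quotient.mk'' g : Quotient (QuotientGroup.rightRel (unipotent n F))) = x ↔
        g * x.out⁻¹ ∈ unipotent n F := by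
      conv_lhs => rw [← Quotient.out_eq' x]
      rw [eq_comm, Quotient.eq'', QuotientGroup.rightRel_apply]
    rw [h1]
    exact ⟨fun h => ⟨⟨_, h⟩, inv_mul_cancel_right _ _⟩, by
      rintro ⟨u, rfl⟩
      rw [mul_inv_cancel_right]
      exact u.2⟩
  rw [hfib, Finset.sum_map]
  simp [hf]

end CosetSum

section Flicker

variable {n : ℕ} {F E V : Type*} [Field F] [Field E] [Algebra F E] [AddCommGroup V] [Module ℂ V]

/-- The index of the last row. -/
def lastIndex (n : ℕ) [NeZero n] : Fin n := ⟨n - 1, Nat.sub_lt (NeZero.pos n) one_pos⟩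

theorem lastRow_eq [NeZero n] : lastRow n F = Pi.single (lastIndex n) 1 := rfl

theorem lastRow_vecMul [NeZero n] (A : Matrix (Fin n) (Fin n) F) :
    lastRow n F ᵥ* A = A (lastIndex n) := by
  rw [lastRow_eq, Matrix.single_one_vecMul, Matrix.row]

theorem vecMul_ne_zero {x : Fin n → F} (hx : x ≠ 0) (g : GL (Fin n) F) : x ᵥ* g.1 ≠ 0 := by
  intro h
  apply hx
  have : (x ᵥ* g.1) ᵥ* (g⁻¹).1 = x := by
    rw [Matrix.vecMul_vecMul, ← Units.val_mul, mul_inv_cancel, Units.val_one, Matrix.vecMul_one]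
  rw [← this, h, Matrix.zero_vecMul]

theorem lastRow_ne_zero [NeZero n] : lastRow n F ≠ 0 := by
  intro h
  have := congrFun h (lastIndex n)
  rw [lastRow_eq, Pi.single_eq_same] at this
  exact one_ne_zero this

theorem lastRow_vecMul_eq_iff [NeZero n] {g : GL (Fin n) F} :
    lastRow n F ᵥ* g.1 = lastRow n F ↔ g ∈ tailUnipotent n (n - 1) F := by
  rw [lastRow_vecMul, lastRow_eq]
  constructor
  · intro h i hi
    have hi' : i = lastIndex n := Fin.ext (by simp only [lastIndex]; omega)
    subst hi'
    exact ⟨fun j hj => by rw [h, Pi.single_eq_of_ne (ne_of_lt hj)],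
      by rw [h, Pi.single_eq_same]⟩
  · intro h
    have h' := h (lastIndex n) le_rfl
    funext j
    by_cases hj : j = lastIndex n
    · rw [hj, h'.2, Pi.single_eq_same]
    · rw [Pi.single_eq_of_ne hj]
      refine h'.1 j (lt_of_le_of_ne ?_ hj)
      rw [Fin.le_def]
      simp only [lastIndex]
      omega

theorem exists_lastRow_vecMul_eq [NeZero n] {x : Fin n → F} (hx : x ≠ 0) :
    ∃ g : GL (Fin n) F, lastRow n F ᵥ* g.1 = x := by
  obtain ⟨g, -, hg⟩ := exists_row_eq (lastIndex n) x (fun i hi => by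
    rw [Fin.lt_def] at hi
    simp only [lastIndex] at hi
    omega) hx
  exact ⟨g, by rw [lastRow_vecMul]; exact funext hg⟩

theorem invTranspose_apply (g : GL (Fin n) E) (i j : Fin n) :
    (invTranspose g).1 i j = (g⁻¹).1 j i := rfl

theorem invTranspose_mul (g h : GL (Fin n) E) :
    invTranspose (g * h) = invTranspose g * invTranspose h := by
  apply Units.ext
  change ((g * h)⁻¹).1ᵀ = (g⁻¹).1ᵀ * (h⁻¹).1ᵀ
  rw [mul_inv_rev, Units.val_mul, Matrix.transpose_mul]

@[simp]
theorem invTranspose_invTranspose (g : GL (Fin n) E) : invTranspose (invTranspose g) = g :=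
  Units.ext (Matrix.transpose_transpose _)

theorem invTranspose_baseGL (h : GL (Fin n) F) :
    invTranspose (baseGL n F E h) = baseGL n F E (invTranspose h) := by
  apply Units.ext
  ext i j
  rw [invTranspose_apply, ← map_inv, baseGL_apply, baseGL_apply, invTranspose_apply]

theorem weyl_mul_apply (g : GL (Fin n) E) (i j : Fin n) :
    (weyl n E * g).1 i j = g.1 (Fin.rev i) j := by
  rw [Units.val_mul, Matrix.mul_apply, Finset.sum_eq_single (Fin.rev i)]
  · simp [weyl]
  · intro l _ hl
    simp [weyl, hl]
  · simp

theorem antiTranspose_weyl_mul (g : GL (Fin n) E) :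
    antiTranspose (weyl n E * invTranspose g) = weyl n E * g⁻¹ := by
  apply Units.ext
  ext i j
  rw [antiTranspose_apply, weyl_mul_apply, weyl_mul_apply, Fin.rev_rev, invTranspose_apply]

theorem weyl_mul_weyl : weyl n E * weyl n E = 1 := by
  apply Units.ext
  ext i j
  rw [weyl_mul_apply, Units.val_one, Matrix.one_apply]
  simp [weyl, eq_comm]

theorem invTranspose_weyl : invTranspose (weyl n E) = weyl n E := by
  apply Units.ext
  ext i j
  rw [invTranspose_apply, inv_eq_of_mul_eq_one_left weyl_mul_weyl]
  simp only [weyl, Matrix.of_apply]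
  have : i = j.rev ↔ j = i.rev := by rw [eq_comm, Fin.rev_eq_iff]
  simp only [this]

theorem baseGL_weyl : baseGL n F E (weyl n F) = weyl n E := by
  apply Units.ext
  ext i j
  rw [baseGL_apply]
  simp only [weyl, Matrix.of_apply]
  split_ifs <;> simp

theorem dualWhittaker_dualWhittaker (W : GL (Fin n) E → ℂ) :
    dualWhittaker (dualWhittaker W) = W := by
  funext g
  rw [dualWhittaker, dualWhittaker, invTranspose_mul, invTranspose_invTranspose,
    invTranspose_weyl, ← mul_assoc, weyl_mul_weyl, one_mul]

theorem dualWhittaker_mul_right (W : GL (Fin n) E → ℂ) (h g : GL (Fin n) E) :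
    dualWhittaker (fun x => W (x * h)) g = dualWhittaker W (g * invTranspose h) := by
  rw [dualWhittaker, dualWhittaker, invTranspose_mul, invTranspose_invTranspose, mul_assoc]

/-- The function `g ↦ l(π(g) v)`. -/
def whittakerFunction (π : Representation ℂ (GL (Fin n) E) V) (l : Module.Dual ℂ V) (v : V) :
    GL (Fin n) E → ℂ :=
  fun g => l (π g v)

/-- Functions on `GL_n(E)` that are invariant under `N_n(F)` on the left. -/
def IsLeftInvariant (F : Type*) [Field F] [Algebra F E] (W : GL (Fin n) E → ℂ) : Prop :=
  ∀ u ∈ unipotent n F, ∀ g, W (baseGL n F E u * g) = W g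

theorem flickerSum_add [Finite F] [NeZero n] (W W' : GL (Fin n) E → ℂ) (φ : (Fin n → F) → ℂ) :
    flickerSum (W + W') φ = flickerSum W φ + flickerSum W' φ := by
  simp only [flickerSum, Pi.add_apply, add_mul, cosetSum_add]

theorem flickerSum_smul [Finite F] [NeZero n] (c : ℂ) (W : GL (Fin n) E → ℂ)
    (φ : (Fin n → F) → ℂ) : flickerSum (c • W) φ = c * flickerSum W φ := by
  simp only [flickerSum, Pi.smul_apply, smul_eq_mul, mul_assoc, cosetSum_const_mul]

theorem flickerSum_add_right [Finite F] [NeZero n] (W : GL (Fin n) E → ℂ)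
    (φ φ' : (Fin n → F) → ℂ) : flickerSum W (φ + φ') = flickerSum W φ + flickerSum W φ' := by
  simp only [flickerSum, Pi.add_apply, mul_add, cosetSum_add]

theorem flickerSum_smul_right [Finite F] [NeZero n] (c : ℂ) (W : GL (Fin n) E → ℂ)
    (φ : (Fin n → F) → ℂ) : flickerSum W (c • φ) = c * flickerSum W φ := by
  simp only [flickerSum, Pi.smul_apply, smul_eq_mul, mul_left_comm _ c, cosetSum_const_mul]

theorem flickerSum_eq_zero [NeZero n] (W : GL (Fin n) E → ℂ) {φ : (Fin n → F) → ℂ}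
    (hφ : ∀ x, x ≠ 0 → φ x = 0) : flickerSum W φ = 0 :=
  cosetSum_eq_zero fun g => by rw [hφ _ (vecMul_ne_zero lastRow_ne_zero g), mul_zero]

theorem card_mul_flickerSum [NeZero n] [Fintype (GL (Fin n) F)] [Fintype (unipotent n F)]
    {W : GL (Fin n) E → ℂ} (hW : IsLeftInvariant F W) (φ : (Fin n → F) → ℂ) :
    (Fintype.card (unipotent n F) : ℂ) * flickerSum W φ =
      ∑ g : GL (Fin n) F, W (baseGL n F E g) * φ (lastRow n F ᵥ* g.1) := by
  refine card_mul_cosetSum fun u hu g => ?_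
  have : lastRow n F ᵥ* (u * g).1 = lastRow n F ᵥ* g.1 := by
    rw [Units.val_mul, ← Matrix.vecMul_vecMul,
      lastRow_vecMul_eq_iff.mpr (unipotent_le_tailUnipotent _ hu)]
  rw [map_mul, hW u hu, this]

theorem flickerSum_translate [Finite F] [NeZero n] {W : GL (Fin n) E → ℂ}
    (hW : IsLeftInvariant F W) (φ : (Fin n → F) → ℂ) (h : GL (Fin n) F) :
    flickerSum (fun g => W (g * baseGL n F E h)) (fun x => φ (x ᵥ* h.1)) = flickerSum W φ := by
  classical
  have := Fintype.ofFinite F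
  have := Fintype.ofFinite (unipotent n F)
  have hc : (Fintype.card (unipotent n F) : ℂ) ≠ 0 := Nat.cast_ne_zero.mpr Fintype.card_ne_zero
  refine mul_left_cancel₀ hc ?_
  rw [card_mul_flickerSum hW, card_mul_flickerSum
    (fun u hu g => by rw [mul_assoc, hW u hu])]
  symm
  rw [← Equiv.sum_comp (Equiv.mulRight h)]
  refine Finset.sum_congr rfl fun g _ => ?_
  rw [Equiv.coe_mulRight, map_mul, Units.val_mul, Matrix.vecMul_vecMul]

theorem fourier_translate [Fintype F] (ψ : AddChar F ℂ) (φ : (Fin n → F) → ℂ) (h : GL (Fin n) F) :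
    fourier ψ (fun x => φ (x ᵥ* h.1)) = fun y => fourier ψ φ (y ᵥ* (invTranspose h).1) := by
  classical
  funext y
  rw [fourier, fourier]
  congr 1
  let e : (Fin n → F) ≃ (Fin n → F) :=
    ⟨fun x => x ᵥ* h.1, fun x => x ᵥ* (h⁻¹).1,
      fun x => by
        simp only [Matrix.vecMul_vecMul, ← Units.val_mul, mul_inv_cancel, Units.val_one,
          Matrix.vecMul_one],
      fun x => by
        simp only [Matrix.vecMul_vecMul, ← Units.val_mul, inv_mul_cancel, Units.val_one,
          Matrix.vecMul_one]⟩
  symm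
  rw [← Equiv.sum_comp e]
  refine Finset.sum_congr rfl fun x _ => ?_
  have h1 : (x ᵥ* h.1) ⬝ᵥ (y ᵥ* (invTranspose h).1) = x ⬝ᵥ y := by
    change (x ᵥ* h.1) ⬝ᵥ (y ᵥ* (h⁻¹).1ᵀ) = x ⬝ᵥ y
    rw [Matrix.vecMul_transpose, Matrix.dotProduct_mulVec, Matrix.vecMul_vecMul, ← Units.val_mul,
      mul_inv_cancel, Units.val_one, Matrix.vecMul_one]
  simp only [e, Equiv.coe_fn_mk, h1]

theorem dualFlickerSum_translate [Fintype F] [NeZero n] (ψ : AddChar F ℂ) {W : GL (Fin n) E → ℂ}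
    (hW : IsLeftInvariant F (dualWhittaker W)) (φ : (Fin n → F) → ℂ) (h : GL (Fin n) F) :
    dualFlickerSum ψ (fun g => W (g * baseGL n F E h)) (fun x => φ (x ᵥ* h.1)) =
      dualFlickerSum ψ W φ := by
  rw [dualFlickerSum, fourier_translate, dualFlickerSum,
    ← flickerSum_translate hW _ (invTranspose h)]
  congr 1
  funext g
  rw [dualWhittaker_mul_right, invTranspose_baseGL]

theorem fourier_add [Fintype F] (ψ : AddChar F ℂ) (φ φ' : (Fin n → F) → ℂ) :
    fourier ψ (φ + φ') = fourier ψ φ + fourier ψ φ' := by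
  funext y
  simp only [fourier, Pi.add_apply, add_mul, Finset.sum_add_distrib, mul_add]

theorem fourier_smul [Fintype F] (ψ : AddChar F ℂ) (c : ℂ) (φ : (Fin n → F) → ℂ) :
    fourier ψ (c • φ) = c • fourier ψ φ := by
  funext y
  simp only [fourier, Pi.smul_apply, smul_eq_mul, mul_assoc, ← Finset.mul_sum]
  ring

/-- The square of the normalizing factor of the Fourier transform. -/
theorem fourier_const_mul_self [Fintype F] :
    (((Fintype.card F : ℝ) ^ (-(n : ℝ) / 2) : ℝ) : ℂ) *
      (((Fintype.card F : ℝ) ^ (-(n : ℝ) / 2) : ℝ) : ℂ) = ((Fintype.card F : ℂ) ^ n)⁻¹ := by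
  have hq : (0 : ℝ) < Fintype.card F := Nat.cast_pos.mpr Fintype.card_pos
  rw [← Complex.ofReal_mul, ← Real.rpow_add hq, add_halves, Real.rpow_neg hq.le, Real.rpow_natCast]
  push_cast
  rfl

/-- Fourier inversion. -/
theorem fourier_inv_fourier [Fintype F] {ψ : AddChar F ℂ} (hψ : ψ ≠ 1) (φ : (Fin n → F) → ℂ) :
    fourier ψ⁻¹ (fourier ψ φ) = φ := by
  classical
  funext z
  have h1 : ∀ x : Fin n → F, ∑ y : Fin n → F, ψ (x ⬝ᵥ y) * ψ⁻¹ (y ⬝ᵥ z) =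
      if x = z then (Fintype.card F : ℂ) ^ n else 0 := by
    intro x
    have h2 := sum_addChar_dotProduct hψ (x - z)
    simp only [sub_eq_zero] at h2
    rw [← h2]
    refine Finset.sum_congr rfl fun y _ => ?_
    rw [AddChar.inv_apply, ← AddChar.map_add_eq_mul, sub_dotProduct, dotProduct_comm y z,
      sub_eq_add_neg]
  have hq : (Fintype.card F : ℂ) ^ n ≠ 0 :=
    pow_ne_zero n (Nat.cast_ne_zero.mpr Fintype.card_ne_zero)
  have h3 : ∑ y : Fin n → F, (∑ x : Fin n → F, φ x * ψ (x ⬝ᵥ y)) * ψ⁻¹ (y ⬝ᵥ z) =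
      φ z * (Fintype.card F : ℂ) ^ n := by
    simp only [Finset.sum_mul, mul_assoc]
    rw [Finset.sum_comm]
    simp only [← Finset.mul_sum, h1]
    simp
  simp only [fourier, mul_assoc, ← Finset.mul_sum]
  rw [h3, ← mul_assoc, fourier_const_mul_self, mul_comm (φ z), inv_mul_cancel_left₀ hq]

theorem fourier_one_apply [Fintype F] {ψ : AddChar F ℂ} (hψ : ψ ≠ 1) {y : Fin n → F} (hy : y ≠ 0) :
    fourier ψ (fun _ => 1) y = 0 := by
  classical
  have := sum_addChar_dotProduct hψ y
  rw [if_neg hy] at this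
  simp only [fourier, one_mul, dotProduct_comm _ y, this, mul_zero]

theorem fourier_single_apply [Fintype F] [DecidableEq F] (ψ : AddChar F ℂ) (x y : Fin n → F) :
    fourier ψ (Pi.single x 1) y =
      (((Fintype.card F : ℝ) ^ (-(n : ℝ) / 2) : ℝ) : ℂ) * ψ (x ⬝ᵥ y) := by
  rw [fourier, Finset.sum_eq_single x]
  · rw [Pi.single_eq_same, one_mul]
  · intro b _ hb
    rw [Pi.single_eq_of_ne hb, zero_mul]
  · simp

theorem IsWhittakerFunctional.isLeftInvariant {π : Representation ℂ (GL (Fin n) E) V}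
    {ψE : AddChar E ℂ} (hψF : ∀ x : F, ψE (algebraMap F E x) = 1) {l : Module.Dual ℂ V}
    (hl : IsWhittakerFunctional π ψE l) (v : V) :
    IsLeftInvariant F (whittakerFunction π l v) := by
  intro u hu g
  rw [whittakerFunction, whittakerFunction, rep_mul_apply,
    hl _ (baseGL_mem_unipotent_iff.mpr hu), superdiagChar_baseGL hψF, one_mul]

theorem whittakerFunction_rep (π : Representation ℂ (GL (Fin n) E) V) (l : Module.Dual ℂ V)
    (h : GL (Fin n) E) (v : V) :
    whittakerFunction π l (π h v) = fun g => whittakerFunction π l v (g * h) := by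
  funext g
  rw [whittakerFunction, whittakerFunction, rep_mul_apply]

end Flicker

/-! ### The dual Whittaker function -/

section Gamma

variable {n : ℕ} {F E V : Type*} [Field F] [Field E] [Algebra F E] [AddCommGroup V] [Module ℂ V]
  {π : Representation ℂ (GL (Fin n) E) V} {ψE : AddChar E ℂ} {l : Module.Dual ℂ V} {v : V}

theorem IsWhittakerPair.bessel_biequivariant (h : IsWhittakerPair π ψE l v) :
    IsBiequivariant ψE (whittakerFunction π l v) := by
  intro u hu g
  simp only [whittakerFunction, rep_mul_apply, h.functional u hu, h.vector u hu, map_smul,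
    smul_eq_mul, and_self]

/-- The dual `W̌` of a translate of the Bessel function of `π` is a translate of the Bessel
function `g ↦ l(π(g⁻¹) v)` of the contragredient, because the Bessel function is invariant under
`g ↦ w_n ᵗg w_n`. -/
theorem IsWhittakerPair.dualWhittaker_rep (hψE : ψE ≠ 1) (h : IsWhittakerPair π ψE l v)
    (a : GL (Fin n) E) :
    dualWhittaker (whittakerFunction π l (π a v)) =
      whittakerFunction π.dual (Module.Dual.eval ℂ V v)
        (π.dual (antiTranspose a * weyl n E)⁻¹ l) := by
  funext g
  have h1 := h.bessel_biequivariant.apply_antiTranspose hψE (weyl n E * invTranspose g * a)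
  rw [antiTranspose_mul, antiTranspose_weyl_mul, ← mul_assoc] at h1
  simp only [whittakerFunction] at h1
  rw [dualWhittaker, whittakerFunction, whittakerFunction, Module.Dual.eval_apply,
    dual_apply_apply, dual_apply_apply, inv_inv, ← rep_mul_apply, ← rep_mul_apply, h1]

theorem IsWhittakerPair.exists_dualWhittaker_eq (hirr : π.IsIrreducible) (hψE : ψE ≠ 1)
    (h : IsWhittakerPair π ψE l v) (w : V) :
    ∃ m : Module.Dual ℂ V, dualWhittaker (whittakerFunction π l w) =
      whittakerFunction π.dual (Module.Dual.eval ℂ V v) m := by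
  have hw : w ∈ Submodule.span ℂ (Set.range fun g => π g v) := by
    rw [span_orbit_eq_top hirr h.ne_zero]; trivial
  induction hw using Submodule.span_induction with
  | mem x hx =>
    obtain ⟨a, rfl⟩ := hx
    exact ⟨_, h.dualWhittaker_rep hψE a⟩
  | zero => exact ⟨0, by funext g; simp [dualWhittaker, whittakerFunction]⟩
  | add x y _ _ hx hy =>
    obtain ⟨a, ha⟩ := hx
    obtain ⟨b, hb⟩ := hy
    refine ⟨a + b, ?_⟩
    funext g
    have ha' := congrFun ha g
    have hb' := congrFun hb g
    simp only [dualWhittaker, whittakerFunction, map_add] at *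
    rw [ha', hb']
  | smul c x _ hx =>
    obtain ⟨a, ha⟩ := hx
    refine ⟨c • a, ?_⟩
    funext g
    have ha' := congrFun ha g
    simp only [dualWhittaker, whittakerFunction, map_smul] at *
    rw [ha']

/-- The Bessel function satisfies `J(g⁻¹) = conj J(g)`: by uniqueness, the Whittaker functional is
the scalar product with the Whittaker vector for an invariant Hermitian form. -/
theorem IsWhittakerPair.bessel_inv [Finite E] (hirr : π.IsIrreducible) (hψE : ψE ≠ 1)
    (h : IsWhittakerPair π ψE l v) (g : GL (Fin n) E) :
    l (π g⁻¹ v) = starRingEnd ℂ (l (π g v)) := by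
  classical
  have := Fintype.ofFinite E
  have := finiteDimensional_of_irreducible hirr
  let b := Module.finBasis ℂ V
  let B : V → V → ℂ := fun x y =>
    ∑ a : GL (Fin n) E, ∑ i, starRingEnd ℂ (b.repr (π a x) i) * b.repr (π a y) i
  have hBinv : ∀ (c : GL (Fin n) E) (x y : V), B (π c x) (π c y) = B x y := by
    intro c x y
    simp only [B, ← rep_mul_apply]
    exact Equiv.sum_comp (Equiv.mulRight c)
      fun a => ∑ i, starRingEnd ℂ (b.repr (π a x) i) * b.repr (π a y) i
  have hBconj : ∀ x y, starRingEnd ℂ (B x y) = B y x := by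
    intro x y
    simp only [B, map_sum, map_mul, Complex.conj_conj, mul_comm]
  have hBpos : B v v ≠ 0 := by
    intro h0
    have h1 : B v v = ((∑ a : GL (Fin n) E, ∑ i, ‖b.repr (π a v) i‖ ^ 2 : ℝ) : ℂ) := by
      simp only [B]
      push_cast
      refine Finset.sum_congr rfl fun a _ => Finset.sum_congr rfl fun i _ => ?_
      rw [mul_comm, Complex.mul_conj, Complex.normSq_eq_norm_sq]
      push_cast
      rfl
    rw [h1, Complex.ofReal_eq_zero, Finset.sum_eq_zero_iff_of_nonneg
      fun a _ => Finset.sum_nonneg fun i _ => sq_nonneg _] at h0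
    have h2 := h0 1 (Finset.mem_univ _)
    rw [Finset.sum_eq_zero_iff_of_nonneg fun i _ => sq_nonneg _] at h2
    refine h.ne_zero (b.repr.map_eq_zero_iff.mp (Finsupp.ext fun i => ?_))
    have h3 := h2 i (Finset.mem_univ _)
    rw [map_one, Module.End.one_apply] at h3
    simpa using h3
  let m : Module.Dual ℂ V :=
    { toFun := fun y => B v y
      map_add' := fun x y => by
        simp only [B, map_add, Finsupp.add_apply, mul_add, Finset.sum_add_distrib]
      map_smul' := fun c x => by
        simp only [B, map_smul, Finsupp.smul_apply, smul_eq_mul, Finset.mul_sum, RingHom.id_apply]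
        simp only [mul_left_comm] }
  have hm : IsWhittakerFunctional π ψE m := by
    intro u hu x
    change B v (π u x) = _ * B v x
    have h1 : B v (π u x) = B (π u⁻¹ v) x := by
      rw [← hBinv u⁻¹ v, ← rep_mul_apply, inv_mul_cancel, map_one, Module.End.one_apply]
    have h2 : starRingEnd ℂ (superdiagChar ψE u)⁻¹ = superdiagChar ψE u := by
      rw [superdiagChar, ← AddChar.map_neg_eq_inv, ← AddChar.map_neg_eq_conj, neg_neg]
    rw [h1, h.vector _ (inv_mem hu), superdiagChar_inv ψE hu]
    simp only [B, map_smul, Finsupp.smul_apply, smul_eq_mul, map_mul, h2, Finset.mul_sum, mul_assoc]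
  have hml : ∀ x, B v x = B v v * l x := fun x =>
    congrArg (fun k : Module.Dual ℂ V => k x) (h.functional_eq hirr hψE hm)
  refine mul_left_cancel₀ hBpos ?_
  rw [← hml, ← hBinv g, ← rep_mul_apply, mul_inv_cancel, map_one, Module.End.one_apply, ← hBconj,
    hml, map_mul, hBconj]

/-! ### The functional equation -/

theorem conj_dualFlickerSum_bessel [Fintype F] [DecidableEq F] [NeZero n] [Finite E]
    (hirr : π.IsIrreducible) (hψE : ψE ≠ 1) (h : IsWhittakerPair π ψE l v) (ψ : AddChar F ℂ)
    (x : Fin n → F) :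
    dualFlickerSum ψ⁻¹ (whittakerFunction π.dual (Module.Dual.eval ℂ V v) l) (Pi.single x 1) =
      starRingEnd ℂ (dualFlickerSum ψ (whittakerFunction π l v) (Pi.single x 1)) := by
  rw [dualFlickerSum, dualFlickerSum, flickerSum, flickerSum, ← cosetSum_conj]
  congr 1
  funext g
  rw [map_mul, fourier_single_apply, fourier_single_apply, map_mul, Complex.conj_ofReal,
    AddChar.inv_apply, AddChar.map_neg_eq_conj]
  congr 1
  exact h.bessel_inv hirr hψE _

/-- The Flicker sum of the Bessel function against the indicator function of `e_n` is `1`. -/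
theorem IsWhittakerPair.flickerSum_bessel [Finite F] [DecidableEq F] [NeZero n] (hψE : ψE ≠ 1)
    (hψF : ∀ x : F, ψE (algebraMap F E x) = 1) (h : IsWhittakerPair π ψE l v) :
    flickerSum (whittakerFunction π l v) (Pi.single (lastRow n F) 1 : (Fin n → F) → ℂ) = 1 := by
  classical
  have := Fintype.ofFinite F
  have := Fintype.ofFinite (unipotent n F)
  have hc : (Fintype.card (unipotent n F) : ℂ) ≠ 0 := Nat.cast_ne_zero.mpr Fintype.card_ne_zero
  refine mul_left_cancel₀ hc ?_
  rw [card_mul_flickerSum (h.functional.isLeftInvariant hψF v), mul_one]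
  have hterm : ∀ g : GL (Fin n) F, whittakerFunction π l v (baseGL n F E g) *
      (Pi.single (lastRow n F) 1 : (Fin n → F) → ℂ) (lastRow n F ᵥ* g.1) =
      if g ∈ unipotent n F then 1 else 0 := by
    intro g
    split_ifs with hg
    · rw [lastRow_vecMul_eq_iff.mpr (unipotent_le_tailUnipotent _ hg), Pi.single_eq_same, mul_one,
        whittakerFunction, h.functional _ (baseGL_mem_unipotent_iff.mpr hg),
        superdiagChar_baseGL hψF, h.normalized, one_mul]
    · by_cases hp : lastRow n F ᵥ* g.1 = lastRow n F
      · have : whittakerFunction π l v (baseGL n F E g) = 0 := by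
          by_contra h0
          exact hg (baseGL_mem_unipotent_iff.mp (h.bessel_biequivariant.mem_unipotent hψE
            (baseGL_mem (lastRow_vecMul_eq_iff.mp hp)) h0))
        rw [this, zero_mul]
      · rw [Pi.single_eq_of_ne hp, mul_zero]
  rw [Finset.sum_congr rfl fun g _ => hterm g, Finset.sum_boole, Fintype.card_subtype]

/-- The bilinear form `(w, φ) ↦ I(W_w, φ)`. -/
def flickerForm (F : Type*) [Field F] [Algebra F E] [Finite F] [NeZero n]
    (π : Representation ℂ (GL (Fin n) E) V) (l : Module.Dual ℂ V) :
    V →ₗ[ℂ] ((Fin n → F) → ℂ) →ₗ[ℂ] ℂ :=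
  LinearMap.mk₂ ℂ (fun w φ => flickerSum (whittakerFunction π l w) φ)
    (fun a b φ => by
      rw [← flickerSum_add]
      congr 1
      funext g
      simp [whittakerFunction])
    (fun c a φ => by
      rw [smul_eq_mul, ← flickerSum_smul]
      congr 1
      funext g
      simp [whittakerFunction])
    (fun a φ φ' => flickerSum_add_right _ φ φ')
    (fun c a φ => flickerSum_smul_right c _ φ)

/-- The bilinear form `(w, φ) ↦ Ǐ(W_w, φ)`. -/
def dualFlickerForm [Fintype F] [NeZero n] (π : Representation ℂ (GL (Fin n) E) V)
    (l : Module.Dual ℂ V) (ψ : AddChar F ℂ) : V →ₗ[ℂ] ((Fin n → F) → ℂ) →ₗ[ℂ] ℂ :=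
  LinearMap.mk₂ ℂ (fun w φ => dualFlickerSum ψ (whittakerFunction π l w) φ)
    (fun a b φ => by
      rw [dualFlickerSum, dualFlickerSum, dualFlickerSum, ← flickerSum_add]
      congr 1
      funext g
      simp [whittakerFunction, dualWhittaker])
    (fun c a φ => by
      rw [smul_eq_mul, dualFlickerSum, dualFlickerSum, ← flickerSum_smul]
      congr 1
      funext g
      simp [whittakerFunction, dualWhittaker])
    (fun a φ φ' => by
      rw [dualFlickerSum, fourier_add, flickerSum_add_right]
      rfl)
    (fun c a φ => by
      rw [dualFlickerSum, fourier_smul, flickerSum_smul_right]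
      rfl)

theorem flickerForm_apply [Finite F] [NeZero n] (w : V) (φ : (Fin n → F) → ℂ) :
    flickerForm F π l w φ = flickerSum (whittakerFunction π l w) φ := rfl

theorem dualFlickerForm_apply [Fintype F] [NeZero n] (ψ : AddChar F ℂ) (w : V)
    (φ : (Fin n → F) → ℂ) :
    dualFlickerForm π l ψ w φ = dualFlickerSum ψ (whittakerFunction π l w) φ := rfl

/-- `D(π(h) w, φ(· h)) = D(w, φ)` for `h ∈ GL_n(F)`. -/
def IsInvariantForm (π : Representation ℂ (GL (Fin n) E) V)
    (D : V →ₗ[ℂ] ((Fin n → F) → ℂ) →ₗ[ℂ] ℂ) : Prop :=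
  ∀ (h : GL (Fin n) F) (w : V) (φ : (Fin n → F) → ℂ),
    D (π (baseGL n F E h) w) (fun x => φ (x ᵥ* h.1)) = D w φ

theorem IsWhittakerPair.flickerForm_invariant [Finite F] [NeZero n]
    (hψF : ∀ x : F, ψE (algebraMap F E x) = 1) (h : IsWhittakerPair π ψE l v) :
    IsInvariantForm π (flickerForm F π l) := by
  intro a w φ
  rw [flickerForm_apply, whittakerFunction_rep,
    flickerSum_translate (h.functional.isLeftInvariant hψF w)]
  rfl

theorem char_inv_algebraMap {ψE : AddChar E ℂ} (hψF : ∀ x : F, ψE (algebraMap F E x) = 1) (x : F) :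
    ψE⁻¹ (algebraMap F E x) = 1 := by
  rw [AddChar.inv_apply, AddChar.map_neg_eq_inv, hψF, inv_one]

theorem IsWhittakerPair.dualFlickerForm_invariant [Fintype F] [NeZero n] (hirr : π.IsIrreducible)
    (hψE : ψE ≠ 1) (hψF : ∀ x : F, ψE (algebraMap F E x) = 1) (h : IsWhittakerPair π ψE l v)
    (ψ : AddChar F ℂ) : IsInvariantForm π (dualFlickerForm π l ψ) := by
  intro a w φ
  obtain ⟨m, hm⟩ := h.exists_dualWhittaker_eq hirr hψE w
  rw [dualFlickerForm_apply, whittakerFunction_rep, dualFlickerSum_translate]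
  · rfl
  · rw [hm]
    exact h.dual.functional.isLeftInvariant (char_inv_algebraMap hψF) m

/-- Invariant forms evaluated at the indicator function of a non-zero vector reduce to the case of
the vector `e_n`, since `GL_n(F)` permutes the non-zero vectors transitively. -/
theorem IsInvariantForm.exists_apply_single [DecidableEq F] [NeZero n]
    {D : V →ₗ[ℂ] ((Fin n → F) → ℂ) →ₗ[ℂ] ℂ} (hD : IsInvariantForm π D) {x : Fin n → F}
    (hx : x ≠ 0) : ∃ h : GL (Fin n) F, ∀ w, D w (Pi.single x 1) =
      D (π (baseGL n F E h) w) (Pi.single (lastRow n F) 1) := by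
  obtain ⟨g, hg⟩ := exists_lastRow_vecMul_eq hx
  refine ⟨g, fun w => ?_⟩
  rw [← hD g w]
  congr 1
  funext y
  by_cases hy : y = lastRow n F
  · rw [hy, hg, Pi.single_eq_same, Pi.single_eq_same]
  · rw [Pi.single_eq_of_ne hy, Pi.single_eq_of_ne]
    rw [← hg]
    intro h
    have h1 : (y - lastRow n F) ᵥ* g.1 = 0 := by rw [Matrix.sub_vecMul, h, sub_self]
    exact vecMul_ne_zero (sub_ne_zero.mpr hy) g h1

theorem IsInvariantForm.mirabolic [DecidableEq F] [NeZero n]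
    {D : V →ₗ[ℂ] ((Fin n → F) → ℂ) →ₗ[ℂ] ℂ} (hD : IsInvariantForm π D) {p : GL (Fin n) F}
    (hp : p ∈ tailUnipotent n (n - 1) F) (w : V) :
    D (π (baseGL n F E p) w) (Pi.single (lastRow n F) 1) = D w (Pi.single (lastRow n F) 1) := by
  rw [← hD p w]
  congr 1
  funext y
  by_cases hy : y = lastRow n F
  · rw [hy, lastRow_vecMul_eq_iff.mpr hp]
  · rw [Pi.single_eq_of_ne hy, Pi.single_eq_of_ne]
    intro h
    rw [← lastRow_vecMul_eq_iff.mpr hp] at h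
    have h1 : (y - lastRow n F) ᵥ* p.1 = 0 := by rw [Matrix.sub_vecMul, h, sub_self]
    exact vecMul_ne_zero (sub_ne_zero.mpr hy) p h1

theorem sum_smul_single {X : Type*} [Fintype X] [DecidableEq X] (φ : X → ℂ) :
    φ = ∑ x, φ x • (Pi.single x 1 : X → ℂ) := by
  funext y
  rw [Finset.sum_apply, Finset.sum_eq_single y]
  · simp
  · intro b _ hb
    rw [Pi.smul_apply, Pi.single_eq_of_ne (Ne.symm hb), smul_zero]
  · simp

/-- An invariant form is determined, on the functions vanishing at `0`, by its value at a Whittaker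
vector and the indicator function of `e_n`. -/
theorem IsInvariantForm.eq_zero [Finite F] [DecidableEq F] [Finite E] [NeZero n]
    (hirr : π.IsIrreducible) (hcusp : IsCuspidal π) (hE : Module.finrank F E = 2) (hψE : ψE ≠ 1)
    (hψF : ∀ x : F, ψE (algebraMap F E x) = 1) (h : IsWhittakerPair π ψE l v)
    {D : V →ₗ[ℂ] ((Fin n → F) → ℂ) →ₗ[ℂ] ℂ} (hD : IsInvariantForm π D)
    (hDv : D v (Pi.single (lastRow n F) 1) = 0) (w : V) {φ : (Fin n → F) → ℂ} (hφ : φ 0 = 0) :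
    D w φ = 0 := by
  have := Fintype.ofFinite F
  have hL : D.flip (Pi.single (lastRow n F) 1) = 0 :=
    functional_eq_zero_of_invariant hirr hcusp hE hψE hψF h.vector h.ne_zero
      (fun p hp w => hD.mirabolic hp w) hDv
  rw [sum_smul_single φ, map_sum]
  refine Finset.sum_eq_zero fun x _ => ?_
  rw [map_smul]
  by_cases hx : x = 0
  · rw [hx, hφ, zero_smul]
  · obtain ⟨a, ha⟩ := hD.exists_apply_single hx
    have h1 : D (π (baseGL n F E a) w) (Pi.single (lastRow n F) 1) = 0 :=
      congrArg (fun k : Module.Dual ℂ V => k (π (baseGL n F E a) w)) hL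
    rw [ha, h1, smul_zero]

section FunctionalEquation

variable [Fintype F] [DecidableEq F] [Finite E] [NeZero n]

/-- The gamma factor is the dual Flicker sum of the Bessel function against the indicator function
of `e_n`. -/
theorem IsWhittakerPair.isAsaiGammaFactor_iff (hirr : π.IsIrreducible) (hcusp : IsCuspidal π)
    (hE : Module.finrank F E = 2) (hψE : ψE ≠ 1) (hψF : ∀ x : F, ψE (algebraMap F E x) = 1)
    (h : IsWhittakerPair π ψE l v) (ψ : AddChar F ℂ) (c : ℂ) :
    IsAsaiGammaFactor π ψ ψE c ↔
      c = dualFlickerSum ψ (whittakerFunction π l v) (Pi.single (lastRow n F) 1) := by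
  constructor
  · intro hc
    have := hc (whittakerFunction π l v)
      ((mem_whittakerModel_iff hirr hψE h).mpr ⟨v, rfl⟩) (Pi.single (lastRow n F) 1)
      (Pi.single_eq_of_ne lastRow_ne_zero.symm _)
    rwa [h.flickerSum_bessel hψE hψF, mul_one] at this
  · rintro rfl W hW φ hφ
    obtain ⟨w, rfl⟩ := (mem_whittakerModel_iff hirr hψE h).mp hW
    set c := dualFlickerSum ψ (whittakerFunction π l v) (Pi.single (lastRow n F) 1)
    have hI := h.flickerForm_invariant (F := F) hψF
    have hI' := h.dualFlickerForm_invariant hirr hψE hψF ψ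
    have hD : IsInvariantForm π (c • flickerForm F π l - dualFlickerForm π l ψ) := by
      intro a x φ
      simp only [LinearMap.sub_apply, LinearMap.smul_apply, hI a x φ, hI' a x φ]
    have h0 := hD.eq_zero hirr hcusp hE hψE hψF h (by
      simp only [LinearMap.sub_apply, LinearMap.smul_apply, flickerForm_apply,
        dualFlickerForm_apply, h.flickerSum_bessel hψE hψF, smul_eq_mul, mul_one]
      exact sub_self _) w hφ
    exact sub_eq_zero.mp h0

theorem IsWhittakerPair.asaiGamma_eq (hirr : π.IsIrreducible) (hcusp : IsCuspidal π)
    (hE : Module.finrank F E = 2) (hψE : ψE ≠ 1) (hψF : ∀ x : F, ψE (algebraMap F E x) = 1)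
    (h : IsWhittakerPair π ψE l v) (ψ : AddChar F ℂ) :
    asaiGamma π ψ ψE =
      dualFlickerSum ψ (whittakerFunction π l v) (Pi.single (lastRow n F) 1) :=
  (h.isAsaiGammaFactor_iff hirr hcusp hE hψE hψF ψ _).mp
    (Classical.epsilon_spec (p := IsAsaiGammaFactor π ψ ψE)
      ⟨_, (h.isAsaiGammaFactor_iff hirr hcusp hE hψE hψF ψ _).mpr rfl⟩)

/-- Complex conjugation carries the gamma factor of `π` to that of its contragredient. -/
theorem IsWhittakerPair.asaiGamma_dual (hirr : π.IsIrreducible) (hcusp : IsCuspidal π)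
    (hE : Module.finrank F E = 2) (hψE : ψE ≠ 1) (hψF : ∀ x : F, ψE (algebraMap F E x) = 1)
    (h : IsWhittakerPair π ψE l v) (ψ : AddChar F ℂ) :
    asaiGamma π.dual ψ⁻¹ ψE⁻¹ = starRingEnd ℂ (asaiGamma π ψ ψE) := by
  rw [h.asaiGamma_eq hirr hcusp hE hψE hψF, h.dual.asaiGamma_eq (isIrreducible_dual hirr)
    (isCuspidal_dual hcusp) hE (inv_char_ne_one hψE) (char_inv_algebraMap hψF),
    conj_dualFlickerSum_bessel hirr hψE h]

end FunctionalEquation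

/-! ### Flicker–Rallis vectors -/

/-- Averaging over `GL_n(F)` produces fixed vectors from invariant functionals. -/
theorem hasFlickerRallisVector_of_functional [Finite F] {L : Module.Dual ℂ V} (hL0 : L ≠ 0)
    (hL : ∀ (g : GL (Fin n) F) (w : V), L (π (baseGL n F E g) w) = L w) :
    HasFlickerRallisVector F π := by
  classical
  have := Fintype.ofFinite F
  obtain ⟨w, hw⟩ : ∃ w, L w ≠ 0 := by
    by_contra! h0
    exact hL0 (LinearMap.ext h0)
  refine ⟨∑ g : GL (Fin n) F, π (baseGL n F E g) w, fun h0 => ?_, fun a => ?_⟩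
  · have h1 := congrArg L h0
    simp only [map_sum, hL, map_zero, Finset.sum_const, Finset.card_univ, nsmul_eq_mul,
      mul_eq_zero, Nat.cast_eq_zero, Fintype.card_ne_zero, hw, or_self] at h1
  · rw [map_sum]
    simp only [← rep_mul_apply, ← map_mul]
    exact Equiv.sum_comp (Equiv.mulLeft a) fun g => π (baseGL n F E g) w

theorem HasFlickerRallisVector.exists_functional [Finite F] (h : HasFlickerRallisVector F π) :
    ∃ L : Module.Dual ℂ V, L ≠ 0 ∧
      ∀ (g : GL (Fin n) F) (w : V), L (π (baseGL n F E g) w) = L w := by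
  classical
  have := Fintype.ofFinite F
  obtain ⟨w, hw0, hw⟩ := h
  obtain ⟨m, hm⟩ : ∃ m : Module.Dual ℂ V, m w ≠ 0 := by
    by_contra! h
    exact hw0 ((Module.forall_dual_apply_eq_zero_iff ℂ w).mp h)
  refine ⟨∑ g : GL (Fin n) F, m ∘ₗ π (baseGL n F E g), fun h0 => ?_, fun a x => ?_⟩
  · have h1 := congrArg (fun k : Module.Dual ℂ V => k w) h0
    simp only [LinearMap.sum_apply, LinearMap.comp_apply, hw, LinearMap.zero_apply,
      Finset.sum_const, Finset.card_univ, nsmul_eq_mul, mul_eq_zero, Nat.cast_eq_zero,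
      Fintype.card_ne_zero, hm, or_self] at h1
  · simp only [LinearMap.sum_apply, LinearMap.comp_apply, ← rep_mul_apply, ← map_mul]
    exact Equiv.sum_comp (Equiv.mulRight a) fun g => m (π (baseGL n F E g) x)

theorem hasFlickerRallisVector_dual_iff [Finite F] :
    HasFlickerRallisVector F π.dual ↔ HasFlickerRallisVector F π := by
  constructor
  · rintro ⟨L, hL0, hL⟩
    refine hasFlickerRallisVector_of_functional hL0 fun g w => ?_
    have := congrArg (fun k : Module.Dual ℂ V => k w) (hL g⁻¹)
    simp only [dual_apply_apply, map_inv, inv_inv] at this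
    exact this
  · intro h
    obtain ⟨L, hL0, hL⟩ := h.exists_functional
    refine ⟨L, hL0, fun g => ?_⟩
    ext w
    rw [dual_apply_apply, ← map_inv, hL]

section Cases

variable [Fintype F] [DecidableEq F] [Finite E] [NeZero n]

/-- Without Flicker–Rallis vectors, the functional equation extends to all functions `φ`: both sides
vanish for constant functions. -/
theorem IsWhittakerPair.functionalEquation (hirr : π.IsIrreducible) (hcusp : IsCuspidal π)
    (hE : Module.finrank F E = 2) (hψE : ψE ≠ 1) (hψF : ∀ x : F, ψE (algebraMap F E x) = 1)
    (h : IsWhittakerPair π ψE l v) {ψ : AddChar F ℂ} (hψ : ψ ≠ 1)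
    (hFR : ¬ HasFlickerRallisVector F π) (w : V) (φ : (Fin n → F) → ℂ) :
    asaiGamma π ψ ψE * flickerSum (whittakerFunction π l w) φ =
      dualFlickerSum ψ (whittakerFunction π l w) φ := by
  have h1 : flickerSum (whittakerFunction π l w) (fun _ : Fin n → F => (1 : ℂ)) = 0 := by
    by_contra hne
    refine hFR (hasFlickerRallisVector_of_functional
      (L := (flickerForm F π l).flip fun _ => 1) (fun h0 => hne ?_) fun g x =>
        h.flickerForm_invariant hψF g x fun _ => 1)
    exact congrArg (fun k : Module.Dual ℂ V => k w) h0
  have h2 : dualFlickerSum ψ (whittakerFunction π l w) (fun _ : Fin n → F => (1 : ℂ)) = 0 :=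
    flickerSum_eq_zero _ fun x hx => fourier_one_apply hψ hx
  have hφ : φ = (φ - φ 0 • fun _ => (1 : ℂ)) + φ 0 • fun _ => (1 : ℂ) := (sub_add_cancel _ _).symm
  have h3 := (h.isAsaiGammaFactor_iff hirr hcusp hE hψE hψF ψ _).mpr
    (h.asaiGamma_eq hirr hcusp hE hψE hψF ψ) _ ((mem_whittakerModel_iff hirr hψE h).mpr ⟨w, rfl⟩)
    (φ - φ 0 • fun _ => (1 : ℂ)) (by simp)
  change asaiGamma π ψ ψE * flickerForm F π l w φ = dualFlickerForm π l ψ w φ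
  change asaiGamma π ψ ψE * flickerForm F π l w _ = dualFlickerForm π l ψ w _ at h3
  change flickerForm F π l w (fun _ => 1) = 0 at h1
  change dualFlickerForm π l ψ w (fun _ => 1) = 0 at h2
  rw [hφ, map_add, map_add, map_smul, map_smul, h1, h2, smul_zero, add_zero, add_zero, h3]

/-- Applying the functional equation twice. -/
theorem IsWhittakerPair.asaiGamma_mul_dual (hirr : π.IsIrreducible) (hcusp : IsCuspidal π)
    (hE : Module.finrank F E = 2) (hψE : ψE ≠ 1) (hψF : ∀ x : F, ψE (algebraMap F E x) = 1)
    (h : IsWhittakerPair π ψE l v) {ψ : AddChar F ℂ} (hψ : ψ ≠ 1)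
    (hFR : ¬ HasFlickerRallisVector F π) :
    asaiGamma π ψ ψE * asaiGamma π.dual ψ⁻¹ ψE⁻¹ = 1 := by
  let δ : (Fin n → F) → ℂ := Pi.single (lastRow n F) 1
  obtain ⟨m, hm⟩ := h.exists_dualWhittaker_eq hirr hψE v
  have h1 := h.functionalEquation hirr hcusp hE hψE hψF hψ hFR v δ
  have h2 := h.dual.functionalEquation (isIrreducible_dual hirr) (isCuspidal_dual hcusp) hE
    (inv_char_ne_one hψE) (char_inv_algebraMap hψF) (inv_char_ne_one hψ)
    (fun h0 => hFR (hasFlickerRallisVector_dual_iff.mp h0)) m (fourier ψ δ)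
  rw [dualFlickerSum, hm] at h1
  rw [dualFlickerSum, fourier_inv_fourier hψ, ← hm, dualWhittaker_dualWhittaker,
    h.flickerSum_bessel hψE hψF, hm, ← h1, h.flickerSum_bessel hψE hψF, mul_one] at h2
  rw [mul_comm, h2]

/-- With a Flicker–Rallis vector, the functional `w ↦ I(W_w, δ_{e_n})`, which is invariant under the
mirabolic subgroup, is invariant under `GL_n(F)`. -/
theorem IsWhittakerPair.flickerForm_single_invariant (hirr : π.IsIrreducible)
    (hcusp : IsCuspidal π) (hE : Module.finrank F E = 2) (hψE : ψE ≠ 1)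
    (hψF : ∀ x : F, ψE (algebraMap F E x) = 1) (h : IsWhittakerPair π ψE l v)
    (hFR : HasFlickerRallisVector F π) (g : GL (Fin n) F) (w : V) :
    flickerForm F π l (π (baseGL n F E g) w) (Pi.single (lastRow n F) 1) =
      flickerForm F π l w (Pi.single (lastRow n F) 1) := by
  obtain ⟨L, hL0, hL⟩ := hFR.exists_functional
  let L₁ : Module.Dual ℂ V := (flickerForm F π l).flip (Pi.single (lastRow n F) 1)
  have hL₁ : ∀ p ∈ tailUnipotent n (n - 1) F, ∀ x, L₁ (π (baseGL n F E p) x) = L₁ x :=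
    fun p hp x => (h.flickerForm_invariant hψF).mirabolic hp x
  have hL₁v : L₁ v = 1 := h.flickerSum_bessel hψE hψF
  have hLv : L v ≠ 0 := fun h0 => hL0 (functional_eq_zero_of_invariant hirr hcusp hE hψE hψF
    h.vector h.ne_zero (fun p _ x => hL p x) h0)
  have heq : L - L v • L₁ = 0 := by
    refine functional_eq_zero_of_invariant hirr hcusp hE hψE hψF h.vector h.ne_zero
      (fun p hp x => ?_) ?_
    · simp only [LinearMap.sub_apply, LinearMap.smul_apply, hL, hL₁ p hp]
    · simp [hL₁v]
  have heq' : ∀ x, L x = L v * L₁ x := fun x =>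
    congrArg (fun k : Module.Dual ℂ V => k x) (sub_eq_zero.mp heq)
  refine mul_left_cancel₀ hLv ?_
  change L v * L₁ (π (baseGL n F E g) w) = L v * L₁ w
  rw [← heq', ← heq', hL]

/-- With a Flicker–Rallis vector, the Flicker sums factor. -/
theorem IsWhittakerPair.flickerSum_eq_sum_mul (hirr : π.IsIrreducible)
    (hcusp : IsCuspidal π) (hE : Module.finrank F E = 2) (hψE : ψE ≠ 1)
    (hψF : ∀ x : F, ψE (algebraMap F E x) = 1) (h : IsWhittakerPair π ψE l v)
    (hFR : HasFlickerRallisVector F π) (w : V) (φ : (Fin n → F) → ℂ) :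
    flickerForm F π l w φ =
      (∑ x, φ x - φ 0) * flickerForm F π l w (Pi.single (lastRow n F) 1) := by
  conv_lhs => rw [sum_smul_single φ]
  rw [map_sum, ← Finset.add_sum_erase _ _ (Finset.mem_univ 0),
    ← Finset.add_sum_erase _ φ (Finset.mem_univ 0), add_sub_cancel_left, Finset.sum_mul, map_smul]
  have h0 : flickerForm F π l w (Pi.single 0 1) = 0 :=
    flickerSum_eq_zero _ fun x hx => Pi.single_eq_of_ne hx _
  rw [h0, smul_zero, zero_add]
  refine Finset.sum_congr rfl fun x hx => ?_
  obtain ⟨a, ha⟩ := (h.flickerForm_invariant hψF).exists_apply_single (Finset.ne_of_mem_erase hx)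
  rw [map_smul, ha, h.flickerForm_single_invariant hirr hcusp hE hψE hψF hFR, smul_eq_mul]

/-- The gamma factor in the presence of a Flicker–Rallis vector. The dual of the Bessel function is
the translate by `w_n ∈ GL_n(F)` of the Bessel function of the contragredient. -/
theorem IsWhittakerPair.asaiGamma_of_hasFlickerRallisVector (hirr : π.IsIrreducible)
    (hcusp : IsCuspidal π) (hE : Module.finrank F E = 2) (hψE : ψE ≠ 1)
    (hψF : ∀ x : F, ψE (algebraMap F E x) = 1) (h : IsWhittakerPair π ψE l v) {ψ : AddChar F ℂ}
    (hψ : ψ ≠ 1) (hFR : HasFlickerRallisVector F π) :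
    asaiGamma π ψ ψE = -(((Fintype.card F : ℝ) ^ (-(n : ℝ) / 2) : ℝ) : ℂ) := by
  have hirr' := isIrreducible_dual hirr
  have hcusp' := isCuspidal_dual hcusp
  have hψE' := inv_char_ne_one hψE
  have hψF' := char_inv_algebraMap hψF
  have hFR' := hasFlickerRallisVector_dual_iff.mpr hFR
  have hd := h.dualWhittaker_rep hψE 1
  rw [map_one, Module.End.one_apply] at hd
  have hι : antiTranspose (1 : GL (Fin n) E) = 1 := by
    apply Units.ext
    ext i j
    rw [antiTranspose_apply, Units.val_one, Matrix.one_apply, Matrix.one_apply]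
    simp [eq_comm]
  rw [hι, one_mul, ← baseGL_weyl (F := F), ← map_inv] at hd
  have hone : flickerForm F π.dual (Module.Dual.eval ℂ V v) l (Pi.single (lastRow n F) 1) = 1 :=
    h.dual.flickerSum_bessel hψE' hψF'
  rw [h.asaiGamma_eq hirr hcusp hE hψE hψF, dualFlickerSum, hd, ← flickerForm_apply,
    h.dual.flickerSum_eq_sum_mul hirr' hcusp' hE hψE' hψF' hFR',
    h.dual.flickerForm_single_invariant hirr' hcusp' hE hψE' hψF' hFR', hone, mul_one]
  simp only [fourier_single_apply, ← Finset.mul_sum]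
  rw [sum_addChar_dotProduct hψ, if_neg lastRow_ne_zero, dotProduct_zero,
    AddChar.map_zero_eq_one, mul_zero, mul_one, zero_sub]

end Cases

end Gamma

end

end FiniteAsai

theorem mainTheorem9 {F E V : Type*} [Field F] [Fintype F] [Field E] [Algebra F E]
    (hE : Module.finrank F E = 2)
    (ψ : AddChar F ℂ) (hψ : ψ ≠ 1)
    (ψE : AddChar E ℂ) (hψE : ψE ≠ 1) (hψEF : ∀ x : F, ψE (algebraMap F E x) = 1)
    (n : ℕ) [NeZero n] [AddCommGroup V] [Module ℂ V]
    (π : Representation ℂ (GL (Fin n) E) V) (hirr : π.IsIrreducible)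
    (hcusp : FiniteAsai.IsCuspidal π) :
    -- both gamma factors are well defined
    (∃! c : ℂ, FiniteAsai.IsAsaiGammaFactor π ψ ψE c) ∧
    (∃! c : ℂ, FiniteAsai.IsAsaiGammaFactor π.dual ψ⁻¹ ψE⁻¹ c) ∧
    -- no Flicker–Rallis vector
    (¬ FiniteAsai.HasFlickerRallisVector F π →
      FiniteAsai.asaiGamma π ψ ψE * FiniteAsai.asaiGamma π.dual ψ⁻¹ ψE⁻¹ = 1 ∧
      ‖FiniteAsai.asaiGamma π ψ ψE‖ = 1) ∧
    -- odd `n` and a Flicker–Rallis vector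
    (Odd n → FiniteAsai.HasFlickerRallisVector F π →
      FiniteAsai.asaiGamma π ψ ψE * FiniteAsai.asaiGamma π.dual ψ⁻¹ ψE⁻¹ =
        ((Fintype.card F : ℂ) ^ n)⁻¹ ∧
      FiniteAsai.asaiGamma π ψ ψE = -(((Fintype.card F : ℝ) ^ (-(n : ℝ) / 2) : ℝ) : ℂ) ∧
      ‖FiniteAsai.asaiGamma π ψ ψE‖ = (Fintype.card F : ℝ) ^ (-(n : ℝ) / 2)) := by
  classical
  have := Module.finite_of_finrank_pos (by rw [hE]; exact two_pos : 0 < Module.finrank F E)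
  have : Finite E := Module.finite_of_finite F
  obtain ⟨l, v, h⟩ := FiniteAsai.exists_isWhittakerPair hirr hcusp hψE
  have hdual := h.asaiGamma_dual hirr hcusp hE hψE hψEF ψ
  refine ⟨⟨_, (h.isAsaiGammaFactor_iff hirr hcusp hE hψE hψEF ψ _).mpr rfl,
      fun c => (h.isAsaiGammaFactor_iff hirr hcusp hE hψE hψEF ψ c).mp⟩,
    ⟨_, (h.dual.isAsaiGammaFactor_iff (FiniteAsai.isIrreducible_dual hirr)
        (FiniteAsai.isCuspidal_dual hcusp) hE (FiniteAsai.inv_char_ne_one hψE)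
        (FiniteAsai.char_inv_algebraMap hψEF) ψ⁻¹ _).mpr rfl,
      fun c => (h.dual.isAsaiGammaFactor_iff (FiniteAsai.isIrreducible_dual hirr)
        (FiniteAsai.isCuspidal_dual hcusp) hE (FiniteAsai.inv_char_ne_one hψE)
        (FiniteAsai.char_inv_algebraMap hψEF) ψ⁻¹ c).mp⟩, fun hFR => ?_, fun _ hFR => ?_⟩
  · have h1 := h.asaiGamma_mul_dual hirr hcusp hE hψE hψEF hψ hFR
    refine ⟨h1, ?_⟩
    rw [hdual, Complex.mul_conj, Complex.normSq_eq_norm_sq] at h1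
    have h2 : ‖FiniteAsai.asaiGamma π ψ ψE‖ ^ 2 = 1 := by exact_mod_cast h1
    exact (pow_eq_one_iff_of_nonneg (norm_nonneg _) two_ne_zero).mp h2
  · have h1 := h.asaiGamma_of_hasFlickerRallisVector hirr hcusp hE hψE hψEF hψ hFR
    have hq : (0 : ℝ) ≤ (Fintype.card F : ℝ) ^ (-(n : ℝ) / 2) :=
      Real.rpow_nonneg (Nat.cast_nonneg _) _
    refine ⟨?_, h1, ?_⟩
    · rw [hdual, h1, map_neg, Complex.conj_ofReal, neg_mul_neg, FiniteAsai.fourier_const_mul_self]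
    · rw [h1, norm_neg, Complex.norm_real, Real.norm_of_nonneg hq]
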